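/- Conventions. A point of $2^\omega$ is an infinite binary sequence. Structures have universe $\omega$ and are identified with their atomic diagrams, coded as points of $2^\omega$, in the relational language with the graph of $+$ for groups and the graphs of $+$ and $\cdot$ for fields. $\operatorname{TFAb}_r\subseteq 2^\omega$ is the space of torsion-free abelian groups of rank $r$, and $\operatorname{FD}_d\subseteq 2^\omega$ is the space of fields of characteristic $0$ and transcendence degree $d$ over $\mathbb{Q}$, each equipped with the isomorphism relation $\cong$. A set $P\subseteq 2^\omega\times 2^\omega$ is (lightface) $\Sigma^0_3$ if there is a c.e. set $W$ of tuples $(x,y,\sigma,\tau)$, with $x,y\in\omega$ and $\sigma,\tau$ finite binary strings, such that $$(A,B)\in P\iff \exists x\,\forall y\,\exists (\sigma,\tau)\ [(x,y,\sigma,\tau)\in W,\ \sigma\prec A,\ \tau\prec B],$$ where $\prec$ means "is an initial segment of". An equivalence relation $E$ on a subspace $S\subseteq 2^\omega$ is $\Sigma^0_3$ if $E=P\cap(S\times S)$ for some $\Sigma^0_3$ set $P$. Let $E,F$ be equivalence relations on $S,T\subseteq 2^\omega$. A computable countable reduction of $E$ to $F$ is a function $g:S^\omega\to T^\omega$, $g=(g_i)_{i\in\omega}$,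 such that $$A_i\mathrel{E}A_j\iff g_i(\vec A)\mathrel{F}g_j(\vec A)\qquad\text{for all }\vec A=(A_n)_{n\in\omega}\in S^\omega\text{ and all } i<j,$$ and such that a single Turing functional computes $\bigoplus_i g_i(\vec A)$ from the oracle $\bigoplus_n A_n$ for every $\vec A\in S^\omega$. Theorem. Under computable countable reducibility, isomorphism on $\operatorname{TFAb}_1$ is complete among $\Sigma^0_3$ equivalence relations. That is, $\cong$ on $\operatorname{TFAb}_1$ is $\Sigma^0_3$, and for every $S\subseteq 2^\omega$ and every $\Sigma^0_3$ equivalence relation $E$ on $S$ there is a computable countable reduction of $E$ to $\cong$ on $\operatorname{TFAb}_1$. Moreover: (a) uniformly for $d>0$, there is a computable countable reduction of $\cong$ on $\operatorname{FD}_d$ to $\cong$ on $\operatorname{TFAb}_1$; (b) uniformly for $r\ge 0$, there is a computable countable reduction of $\cong$ on $\operatorname{TFAb}_r$ to $\cong$ on $\operatorname{TFAb}_1$. Here "uniformly" means that one Turing functional, taking $d$ (respectively $r$) as an additional input, computes a reduction for every such $d$ (respectively $r$). -/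

import Mathlib

/-- The Cantor space `2^ω`; a point is also viewed as a subset of `ω`. -/
abbrev CantorSeq : Type := ℕ → Bool

/-! ### Oracle computations -/

/-- Programs with access to an oracle: the codes of Mathlib's partial recursive functions together
with one further instruction, `oracle`, which queries the oracle. -/
inductive OracleCode : Type
  | zero : OracleCode
  | succ : OracleCode
  | left : OracleCode
  | right : OracleCode
  | oracle : OracleCode
  | pair : OracleCode → OracleCode → OracleCode
  | comp : OracleCode → OracleCode → OracleCode
  | prec : OracleCode → OracleCode → OracleCode
  | rfind : OracleCode → OracleCode

/-- The partial function computed by a program with oracle `X`. The clauses are those of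
`Nat.RecursiveIn`; the query `n` is answered by `1` if `X n = true` and by `0` otherwise. The map
`X ↦ c.eval X` is the Turing functional with program `c`. -/
def OracleCode.eval (X : CantorSeq) : OracleCode → ℕ →. ℕ
  | .zero => pure 0
  | .succ => Nat.succ
  | .left => ↑fun n : ℕ => n.unpair.1
  | .right => ↑fun n : ℕ => n.unpair.2
  | .oracle => ↑fun n : ℕ => (X n).toNat
  | .pair cf cg => fun n => Nat.pair <$> eval X cf n <*> eval X cg n
  | .comp cf cg => fun n => eval X cg n >>= eval X cf
  | .prec cf cg =>
    Nat.unpaired fun a n =>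
      n.rec (eval X cf a) fun y IH => do
        let i ← IH
        eval X cg (Nat.pair a (Nat.pair y i))
  | .rfind cf => fun a =>
    Nat.rfind fun n => (fun m => m = 0) <$> eval X cf (Nat.pair a n)

/-- The join `A₀ ⊕ A₁ ⊕ ⋯` of countably many points of `2^ω`. -/
def seqJoin (A : ℕ → CantorSeq) : CantorSeq :=
  fun n => A n.unpair.1 n.unpair.2

/-! ### Computable countable reductions -/

/-- `g : S^ω → T^ω` is a countable (that is, `ω`-ary) reduction of `E` to `F`. -/
def IsCountableReduction {S T : Set CantorSeq} (E : Setoid S) (F : Setoid T)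
    (g : (ℕ → S) → (ℕ → T)) : Prop :=
  ∀ A : ℕ → S, ∀ i j : ℕ, i < j → (E (A i) (A j) ↔ F (g A i) (g A j))

/-- `g : S^ω → T^ω` is computable: a single program computes the join of the output sequence from
the join of the input sequence as oracle, for every sequence in `S^ω`. -/
def IsComputableOnSeqs {S T : Set CantorSeq} (g : (ℕ → S) → (ℕ → T)) : Prop :=
  ∃ c : OracleCode, ∀ (A : ℕ → S) (n : ℕ),
    c.eval (seqJoin fun i => (A i : CantorSeq)) n =
      Part.some (seqJoin (fun i => (g A i : CantorSeq)) n).toNat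

/-- `E` is reducible to `F` by a computable countable reduction. -/
def ComputablyCountablyReducible {S T : Set CantorSeq} (E : Setoid S) (F : Setoid T) : Prop :=
  ∃ g : (ℕ → S) → (ℕ → T), IsComputableOnSeqs g ∧ IsCountableReduction E F g

/-- The relations `E d`, for `d ∈ D`, are reducible to `F` by computable countable reductions,
uniformly in `d`: a single program, given `d` as part of its input, computes a reduction of `E d`
to `F`, for every `d ∈ D`. -/
def UniformlyComputablyCountablyReducible (D : Set ℕ) {S : ℕ → Set CantorSeq} {T : Set CantorSeq}
    (E : ∀ d, Setoid (S d)) (F : Setoid T) : Prop :=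
  ∃ c : OracleCode, ∀ d ∈ D, ∃ g : (ℕ → S d) → (ℕ → T),
    (∀ (A : ℕ → S d) (n : ℕ),
      c.eval (seqJoin fun i => (A i : CantorSeq)) (Nat.pair d n) =
        Part.some (seqJoin (fun i => (g A i : CantorSeq)) n).toNat) ∧
    IsCountableReduction (E d) F g

/-! ### The class `Σ⁰₃` -/

/-- The basic clopen subset of `2^ω` given by a finite binary string. -/
def binaryCylinder (σ : List Bool) : Set CantorSeq :=
  {A | ∀ (i : ℕ) (h : i < σ.length), A i = σ[i]}

/-- The (lightface) `Σ⁰₃` subsets of `2^ω × 2^ω`: effective unions of effective intersections of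
c.e. unions of basic clopen sets. The c.e. set `W` lists, uniformly in `x` and `y`, the basic
clopen sets whose union is the set with index `(x, y)`. -/
def IsSigma03Set (P : Set (CantorSeq × CantorSeq)) : Prop :=
  ∃ W : (ℕ × ℕ) × (List Bool × List Bool) → Prop, REPred W ∧
    P = ⋃ x : ℕ, ⋂ y : ℕ, ⋃ σ : List Bool, ⋃ τ : List Bool, ⋃ _ : W ((x, y), (σ, τ)),
      binaryCylinder σ ×ˢ binaryCylinder τ

/-- A `Σ⁰₃` equivalence relation on a subspace `S` of `2^ω`: the trace on `S × S` of a `Σ⁰₃` subset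
of `2^ω × 2^ω`. -/
def IsSigma03Equiv {S : Set CantorSeq} (E : Setoid S) : Prop :=
  ∃ P : Set (CantorSeq × CantorSeq), IsSigma03Set P ∧
    ∀ A B : S, E A B ↔ ((A : CantorSeq), (B : CantorSeq)) ∈ P

/-- `F` is complete among `Σ⁰₃` equivalence relations on subspaces of `2^ω`, under computable
countable reducibility. -/
def IsSigma03CompleteEquiv {T : Set CantorSeq} (F : Setoid T) : Prop :=
  IsSigma03Equiv F ∧
    ∀ (S : Set CantorSeq) (E : Setoid S), IsSigma03Equiv E → ComputablyCountablyReducible E F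

/-! ### Torsion-free abelian groups with universe `ω`

The language has one ternary relation symbol, for the graph of `+`; the atomic sentence
`a + b = c` has index `⟨a, b, c⟩`. -/

/-- The index of a triple of natural numbers. -/
def tripleIndex (a b c : ℕ) : ℕ := Nat.pair a (Nat.pair b c)

/-- The space `TFAb_r`: the atomic diagrams of the torsion-free abelian groups of rank `r` with
universe `ω`. The bijection `e` transports such a structure to `ω`. -/
def TFAbSpace (r : ℕ) : Set CantorSeq :=
  {X | ∃ (G : Type) (_ : AddCommGroup G) (e : G ≃ ℕ),
    IsAddTorsionFree G ∧ Module.rank ℤ G = (r : Cardinal) ∧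
    ∀ a b c : G, X (tripleIndex (e a) (e b) (e c)) = true ↔ a + b = c}

/-- Isomorphism of structures with universe `ω` on the space `TFAb_r`. -/
def TFAbIso (r : ℕ) : Setoid (TFAbSpace r) where
  r X Y := ∃ s : Equiv.Perm ℕ, ∀ a b c : ℕ,
    X.1 (tripleIndex a b c) = Y.1 (tripleIndex (s a) (s b) (s c))
  iseqv :=
    { refl := fun _ => ⟨1, fun _ _ _ => rfl⟩
      symm := fun ⟨s, h⟩ => ⟨s.symm, fun a b c => by simp [h]⟩
      trans := fun ⟨s, h⟩ ⟨t, k⟩ => ⟨s.trans t, fun a b c => by simp [h, k]⟩ }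

/-! ### Fields with universe `ω`

The language has two ternary relation symbols, for the graphs of `+` and of `·`; the atomic
sentences `a + b = c` and `a · b = c` have the indices `2⟨a, b, c⟩` and `2⟨a, b, c⟩ + 1`. -/

/-- The space `FD_d`: the atomic diagrams of the fields of characteristic `0` and transcendence
degree `d` over `ℚ`, with universe `ω`. -/
def FDSpace (d : ℕ) : Set CantorSeq :=
  {X | ∃ (K : Type) (_ : Field K) (_ : CharZero K) (e : K ≃ ℕ),
    Algebra.trdeg ℚ K = (d : Cardinal) ∧
    (∀ a b c : K, X (2 * tripleIndex (e a) (e b) (e c)) = true ↔ a + b = c) ∧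
    ∀ a b c : K, X (2 * tripleIndex (e a) (e b) (e c) + 1) = true ↔ a * b = c}

/-- Isomorphism of structures with universe `ω` on the space `FD_d`. -/
def FDIso (d : ℕ) : Setoid (FDSpace d) where
  r X Y := ∃ s : Equiv.Perm ℕ, ∀ a b c : ℕ,
    X.1 (2 * tripleIndex a b c) = Y.1 (2 * tripleIndex (s a) (s b) (s c)) ∧
    X.1 (2 * tripleIndex a b c + 1) = Y.1 (2 * tripleIndex (s a) (s b) (s c) + 1)
  iseqv :=
    { refl := fun _ => ⟨1, fun _ _ _ => ⟨rfl, rfl⟩⟩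
      symm := fun ⟨s, h⟩ => ⟨s.symm, fun a b c => by simp [h]⟩
      trans := fun ⟨s, h⟩ ⟨t, k⟩ => ⟨s.trans t, fun a b c => by simp [h, k]⟩ }

/-!
All three claims come down to one fact: isomorphism, on each of the spaces, has a `Σ⁰₃` definition
`∃ x, ∀ y, ∃ s, V ((x, y), (A ↾ s, B ↾ s))` with a primitive recursive matrix `V` that does not
depend on the rank or the transcendence degree (`Sigma03Normal`), and a single program reduces every
equivalence relation with a given matrix `V` to isomorphism on `TFAb_1`
(`exists_oracleCode_reduction`).

*Hardness.* Given `A₀, A₁, …`, sets `W₀, W₁, …` are enumerated in the join of the `Aᵢ` such that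
`Aᵢ E Aⱼ` holds exactly if `Wᵢ` and `Wⱼ` differ by a finite set. Say that the triple `t = ⟨i, j, x⟩`
reaches level `v` if the innermost condition is met for all `y < v`; so `Aᵢ E Aⱼ` holds exactly if
some such triple reaches all levels. A finite guess `L` says which of the triples `t < |L|` do, and which
`i < |L|` make up an equivalence class closed under these triples. The pair of `L` and a level `v` is
put into all sets as soon as a triple deemed bad by `L` gets beyond `v`, and into the sets with index
in the guessed class when such a triple gets to `v`. If a triple `t` shows that `Aᵢ E Aⱼ`, then a
guess with `|L| > t` either deems `t` bad, and its pairs go into all sets, or has `i` and `j` in the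
class together or not at all; for each of the finitely many shorter guesses only one level matters
(`EquivGuess.finite_symmDiff_enum`). If `Aᵢ E Aⱼ` fails, then the correct guesses about the class of
`i` separate `Wᵢ` from `Wⱼ` infinitely often (`EquivGuess.infinite_symmDiff_enum`).
The set `W` is then replaced by the group of the rationals whose denominators divide products of
distinct Fermat numbers with index in `W`. As Fermat numbers are pairwise coprime, two such groups
are isomorphic exactly if the sets differ finitely (`nonempty_fermatGroup_equiv_iff`). Listing the
elements of the group in the order of their enumeration gives it the universe `ω`
(`exists_oracleCode_presentation`).

*Definability.* Torsion-free abelian groups of finite rank and fields of characteristic zero and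
finite transcendence degree have two features in common (`IsFinitelyAlgebraic`): an equation between
unary polynomial functions that is not an identity has finitely many solutions, and each element
solves such an equation with constants from a fixed finite set `C`. So `X` and `Y` are isomorphic
exactly if there are finite tuples `C`, `C'` over which all elements of `X` and `Y` are algebraic in
this sense, and such that each finite part of the diagram of `X` embeds into `Y` taking `C` to `C'`,
and conversely. Indeed, a limit of the finite embeddings along an ultrafilter exists because each
element has finitely many possible images (`exists_embedding`), and the composition of the embeddings
obtained in the two directions is onto because it permutes the solutions of each equation with
constants from `C` (`surjective_of_selfEmbedding`). This condition has the form `∃ ∀ ∃`.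
-/

/-! ### Bounded quantifiers -/

section BoundedQuantifiers

variable {α β : Type*} [Primcodable α] [Primcodable β]

theorem PrimrecPred.ball_mem {f : α → List β} {p : α → β → Prop} (hf : Primrec f)
    (hp : PrimrecPred fun q : α × β => p q.1 q.2) : PrimrecPred fun a => ∀ x ∈ f a, p a x :=
  (PrimrecRel.forall_mem_list (R := fun (x : β) (a : α) => p a x)
    (hp.comp (Primrec.pair Primrec.snd Primrec.fst))).comp hf Primrec.id

theorem PrimrecPred.bex_mem {f : α → List β} {p : α → β → Prop} (hf : Primrec f)
    (hp : PrimrecPred fun q : α × β => p q.1 q.2) : PrimrecPred fun a => ∃ x ∈ f a, p a x :=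
  (PrimrecRel.exists_mem_list (R := fun (x : β) (a : α) => p a x)
    (hp.comp (Primrec.pair Primrec.snd Primrec.fst))).comp hf Primrec.id

theorem PrimrecPred.ball_lt {f : α → ℕ} {p : α → ℕ → Prop} (hf : Primrec f)
    (hp : PrimrecPred fun q : α × ℕ => p q.1 q.2) : PrimrecPred fun a => ∀ x < f a, p a x :=
  (PrimrecPred.ball_mem (Primrec.list_range.comp hf) hp).of_eq (by simp)

theorem PrimrecPred.bex_lt {f : α → ℕ} {p : α → ℕ → Prop} (hf : Primrec f)
    (hp : PrimrecPred fun q : α × ℕ => p q.1 q.2) : PrimrecPred fun a => ∃ x < f a, p a x :=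
  (PrimrecPred.bex_mem (Primrec.list_range.comp hf) hp).of_eq (by simp)

theorem PrimrecPred.imp {p q : α → Prop} (hp : PrimrecPred p) (hq : PrimrecPred q) :
    PrimrecPred fun a => p a → q a :=
  (hp.not.or hq).of_eq fun _ => imp_iff_not_or.symm

end BoundedQuantifiers

/-! ### Initial segments of points of the Cantor space -/

/-- The initial segment of length `s` of a point of the Cantor space. -/
def initSeg (X : CantorSeq) (s : ℕ) : List Bool := (List.range s).map X

theorem initSeg_succ (X : CantorSeq) (s : ℕ) : initSeg X (s + 1) = initSeg X s ++ [X s] := by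
  simp [initSeg, List.range_succ]

@[simp] theorem initSeg_length (X : CantorSeq) (s : ℕ) : (initSeg X s).length = s := by
  simp [initSeg]

theorem initSeg_getElem? (X : CantorSeq) (s i : ℕ) :
    (initSeg X s)[i]? = if i < s then some (X i) else none := by
  by_cases h : i < s <;> simp [initSeg, h]

theorem initSeg_getElem?_of_lt (X : CantorSeq) {s i : ℕ} (h : i < s) :
    (initSeg X s)[i]? = some (X i) := by
  simp [initSeg, h]

theorem initSeg_getD (X : CantorSeq) {s i : ℕ} (h : i < s) (b : Bool) :
    (initSeg X s).getD i b = X i := by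
  rw [List.getD_eq_getElem?_getD, initSeg_getElem?_of_lt X h, Option.getD_some]

theorem take_initSeg (X : CantorSeq) {s u : ℕ} (h : u ≤ s) :
    (initSeg X s).take u = initSeg X u := by
  simp [initSeg, ← List.map_take, List.take_range, h]

theorem mem_binaryCylinder_iff (σ : List Bool) (A : CantorSeq) :
    A ∈ binaryCylinder σ ↔ σ = initSeg A σ.length := by
  constructor
  · intro h
    refine List.ext_getElem (by simp) fun i h₁ h₂ => ?_
    simpa [initSeg] using (h i h₁).symm
  · intro h i hi
    have : σ[i]? = some (A i) := by rw [h, initSeg_getElem?_of_lt A hi]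
    rw [List.getElem?_eq_getElem hi] at this
    exact (Option.some.inj this).symm

/-! ### Turing functionals that read an initial segment of the oracle -/

namespace OracleCode

/-- Oracle programs compute all partial recursive functions, ignoring the oracle. -/
theorem exists_eval_eq {f : ℕ →. ℕ} (hf : Nat.Partrec f) :
    ∃ c : OracleCode, ∀ X, c.eval X = f := by
  induction hf with
  | zero => exact ⟨.zero, fun X => rfl⟩
  | succ => exact ⟨.succ, fun X => rfl⟩
  | left => exact ⟨.left, fun X => rfl⟩
  | right => exact ⟨.right, fun X => rfl⟩
  | pair _ _ ihf ihg =>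
    obtain ⟨cf, hf⟩ := ihf
    obtain ⟨cg, hg⟩ := ihg
    exact ⟨.pair cf cg, fun X => by simp only [eval, hf, hg]; rfl⟩
  | comp _ _ ihf ihg =>
    obtain ⟨cf, hf⟩ := ihf
    obtain ⟨cg, hg⟩ := ihg
    exact ⟨.comp cf cg, fun X => by simp only [eval, hf, hg]; rfl⟩
  | prec _ _ ihf ihg =>
    obtain ⟨cf, hf⟩ := ihf
    obtain ⟨cg, hg⟩ := ihg
    exact ⟨.prec cf cg, fun X => by simp only [eval, hf, hg]; rfl⟩
  | rfind _ ihf =>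
    obtain ⟨cf, hf⟩ := ihf
    exact ⟨.rfind cf, fun X => by simp only [eval, hf]; rfl⟩

theorem exists_eval_eq_of_computable {f : ℕ → ℕ} (hf : Computable f) :
    ∃ c : OracleCode, ∀ X n, c.eval X n = Part.some (f n) := by
  obtain ⟨c, hc⟩ := exists_eval_eq (Partrec.nat_iff.1 hf)
  exact ⟨c, fun X n => by rw [hc]; rfl⟩

theorem eval_comp_of_eq {X : CantorSeq} {cf cg : OracleCode} {n m : ℕ}
    (h : cg.eval X n = Part.some m) : (comp cf cg).eval X n = cf.eval X m := by
  change (cg.eval X n).bind (cf.eval X) = _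
  rw [h]
  exact Part.bind_some m (cf.eval X)

theorem eval_pair_of_eq {X : CantorSeq} {cf cg : OracleCode} {n a b : ℕ}
    (hf : cf.eval X n = Part.some a) (hg : cg.eval X n = Part.some b) :
    (pair cf cg).eval X n = Part.some (Nat.pair a b) := by
  change Nat.pair <$> cf.eval X n <*> cg.eval X n = _
  rw [hf, hg]
  simp [Seq.seq]

theorem eval_prec_succ_of_eq {X : CantorSeq} {cf cg : OracleCode} {a n i : ℕ}
    (h : (prec cf cg).eval X (Nat.pair a n) = Part.some i) :
    (prec cf cg).eval X (Nat.pair a (n + 1)) = cg.eval X (Nat.pair a (Nat.pair n i)) := by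
  simp only [eval, Nat.unpaired, Nat.unpair_pair] at h ⊢
  exact (congrArg (fun p : Part ℕ => p.bind fun i => cg.eval X (Nat.pair a (Nat.pair n i))) h).trans
    (Part.bind_some _ _)

/-- A program that reads off an initial segment of the oracle; the list comes out reversed, as
primitive recursion adds the new entries in front. -/
theorem exists_eval_initSeg : ∃ c : OracleCode, ∀ X a s,
    c.eval X (Nat.pair a s) = Part.some (Encodable.encode (initSeg X s).reverse) := by
  have hleft : ∀ X a b, left.eval X (Nat.pair a b) = Part.some a := fun X a b => by
    change Part.some (Nat.pair a b).unpair.1 = _; simp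
  have hright : ∀ X a b, right.eval X (Nat.pair a b) = Part.some b := fun X a b => by
    change Part.some (Nat.pair a b).unpair.2 = _; simp
  refine ⟨.prec .zero (.comp .succ (.pair (.comp .oracle (.comp .left .right))
    (.comp .right .right))), fun X a s => ?_⟩
  induction s with
  | zero => simp [eval, Nat.unpaired]; rfl
  | succ s ih =>
    rw [eval_prec_succ_of_eq ih]
    have h₁ : (comp oracle (comp left right)).eval X
        (Nat.pair a (Nat.pair s (Encodable.encode (initSeg X s).reverse))) =
        Part.some (X s).toNat := by
      rw [eval_comp_of_eq (by rw [eval_comp_of_eq (hright ..), hleft])]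
      rfl
    rw [eval_comp_of_eq (eval_pair_of_eq h₁ (by rw [eval_comp_of_eq (hright ..), hright]))]
    cases h : X s <;> simp [initSeg_succ, h] <;> rfl

/-- If `H n σ` is computable, and on the initial segments `σ` of `X` is eventually defined and
takes no value but `v X n`, then `v` is a Turing functional. -/
theorem exists_eval_of_initSeg {H : ℕ → List Bool → Option ℕ} (hH : Computable₂ H) :
    ∃ c : OracleCode, ∀ X n v, (∃ s, H n (initSeg X s) ≠ none) →
      (∀ s, H n (initSeg X s) = none ∨ H n (initSeg X s) = some v) →
      c.eval X n = Part.some v := by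
  obtain ⟨ci, hi⟩ := exists_eval_initSeg
  have hh : Computable fun p : ℕ => Encodable.encode
      (H p.unpair.1 ((Encodable.decode p.unpair.2 : Option (List Bool)).getD []).reverse) := by
    refine Computable.encode.comp (hH.comp (Primrec.fst.comp Primrec.unpair).to_comp ?_)
    exact (Primrec.list_reverse.comp (Primrec.option_getD.comp (Primrec.decode.comp
      (Primrec.snd.comp Primrec.unpair)) (Primrec.const []))).to_comp
  obtain ⟨ch, hch⟩ := exists_eval_eq_of_computable hh
  obtain ⟨ct, hct⟩ := exists_eval_eq_of_computable (f := fun e => 1 - e)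
    (Primrec.nat_sub.comp (Primrec.const 1) Primrec.id).to_comp
  obtain ⟨cp, hcp⟩ := exists_eval_eq_of_computable (f := Nat.pred) Primrec.pred.to_comp
  obtain ⟨cid, hcid⟩ := exists_eval_eq_of_computable (f := id) Primrec.id.to_comp
  have hval : ∀ X n s, (comp ch (pair left ci)).eval X (Nat.pair n s) =
      Part.some (Encodable.encode (H n (initSeg X s))) := by
    intro X n s
    have h₁ : left.eval X (Nat.pair n s) = Part.some n := by
      change Part.some (Nat.pair n s).unpair.1 = _
      simp
    rw [eval_comp_of_eq (eval_pair_of_eq h₁ (hi X n s)), hch]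
    simp
  refine ⟨comp cp (comp (comp ch (pair left ci))
    (pair cid (rfind (comp ct (comp ch (pair left ci)))))), fun X n v hex hv => ?_⟩
  have hfind : ∃ s, (rfind (comp ct (comp ch (pair left ci)))).eval X n = Part.some s ∧
      H n (initSeg X s) = some v := by
    classical
    have hs := Nat.find_spec hex
    have hmin := fun m => Nat.find_min hex (m := m)
    generalize Nat.find hex = s at hs hmin
    refine ⟨s, ?_, (hv s).resolve_left hs⟩
    rw [Part.eq_some_iff]
    refine Nat.mem_rfind.2 ?_
    have key : ∀ m, (comp ct (comp ch (pair left ci))).eval X (Nat.pair n m) =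
        Part.some (1 - Encodable.encode (H n (initSeg X m))) := by
      intro m
      rw [eval_comp_of_eq (hval X n m), hct]
    constructor
    · refine (Part.mem_map_iff _).2 ⟨0, ?_, by simp⟩
      rw [key, (hv s).resolve_left hs]
      simp
    · intro m hm
      refine (Part.mem_map_iff _).2 ⟨1, ?_, by simp⟩
      rw [key, not_not.1 (hmin m hm)]
      simp
  obtain ⟨s, hs, hHs⟩ := hfind
  have : (pair cid (rfind (comp ct (comp ch (pair left ci))))).eval X n =
      Part.some (Nat.pair n s) := eval_pair_of_eq (hcid X n) hs
  rw [eval_comp_of_eq (by rw [eval_comp_of_eq this, hval]), hcp, hHs]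
  simp

end OracleCode

/-! ### A normal form for `Σ⁰₃` relations -/

/-- The `Σ⁰₃` relation on `2^ω` with matrix `V`: the innermost quantifier asks for a common length
of initial segments, which makes it possible to take `V` primitive recursive. -/
def Sigma03Normal (V : (ℕ × ℕ) × (List Bool × List Bool) → Prop) (A B : CantorSeq) : Prop :=
  ∃ x, ∀ y, ∃ s, V ((x, y), (initSeg A s, initSeg B s))

/-- An r.e. predicate is the projection of a primitive recursive one. -/
theorem REPred.exists_primrecPred {α : Type*} [Primcodable α] {p : α → Prop} (hp : REPred p) :
    ∃ R : α × ℕ → Prop, PrimrecPred R ∧ ∀ a, p a ↔ ∃ k, R (a, k) := by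
  classical
  obtain ⟨c, hc⟩ := Nat.Partrec.Code.exists_code.1 hp
  refine ⟨fun q => (Nat.Partrec.Code.evaln q.2 c (Encodable.encode q.1)).isSome = true, ?_, ?_⟩
  · refine Primrec.eq.comp (Primrec.option_isSome.comp ?_) (Primrec.const true)
    exact Nat.Partrec.Code.primrec_evaln.comp (((Primrec.snd).pair (Primrec.const c)).pair
      (Primrec.encode.comp Primrec.fst))
  · intro a
    have h₁ : p a ↔ (c.eval (Encodable.encode a)).Dom := by
      rw [hc]
      simp [Part.assert]
    rw [h₁, Part.dom_iff_mem]
    simp only [Nat.Partrec.Code.evaln_complete, Option.isSome_iff_exists, Option.mem_def]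
    exact exists_comm

theorem take_initSeg_eq_iff {σ : List Bool} {A : CantorSeq} {s : ℕ} :
    (initSeg A s).take σ.length = σ ↔ A ∈ binaryCylinder σ ∧ σ.length ≤ s := by
  rw [mem_binaryCylinder_iff]
  constructor
  · intro h
    have hl := congrArg List.length h
    rw [List.length_take, initSeg_length] at hl
    have hs : σ.length ≤ s := by omega
    rw [take_initSeg A hs] at h
    exact ⟨h.symm, hs⟩
  · rintro ⟨h, hs⟩
    rw [take_initSeg A hs]
    exact h.symm

theorem IsSigma03Set.exists_normal {P : Set (CantorSeq × CantorSeq)} (hP : IsSigma03Set P) :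
    ∃ V, PrimrecPred V ∧ ∀ A B, (A, B) ∈ P ↔ Sigma03Normal V A B := by
  obtain ⟨W, hW, rfl⟩ := hP
  obtain ⟨R, hR, hWR⟩ := hW.exists_primrecPred
  -- The length of the initial segments also codes the strings and the stage to be looked at.
  let w : List Bool → (List Bool × List Bool) × ℕ := fun α =>
    (Encodable.decode α.length.unpair.1).getD (([], []), 0)
  have hw : Primrec w := Primrec.option_getD.comp (Primrec.decode.comp (Primrec.fst.comp
    (Primrec.unpair.comp Primrec.list_length))) (Primrec.const _)
  refine ⟨fun q => q.2.1.take (w q.2.1).1.1.length = (w q.2.1).1.1 ∧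
    q.2.2.take (w q.2.1).1.2.length = (w q.2.1).1.2 ∧ R ((q.1, (w q.2.1).1), (w q.2.1).2), ?_, ?_⟩
  · have hα : Primrec fun q : (ℕ × ℕ) × (List Bool × List Bool) => q.2.1 :=
      Primrec.fst.comp Primrec.snd
    have hβ : Primrec fun q : (ℕ × ℕ) × (List Bool × List Bool) => q.2.2 :=
      Primrec.snd.comp Primrec.snd
    have hwα := hw.comp hα
    have hσ := Primrec.fst.comp (Primrec.fst.comp hwα)
    have hτ := Primrec.snd.comp (Primrec.fst.comp hwα)
    refine (Primrec.eq.comp (Primrec.list_take.comp (Primrec.list_length.comp hσ) hα) hσ).and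
      ((Primrec.eq.comp (Primrec.list_take.comp (Primrec.list_length.comp hτ) hβ) hτ).and
        (hR.comp ((Primrec.fst.pair (Primrec.fst.comp hwα)).pair (Primrec.snd.comp hwα))))
  · intro A B
    simp only [Set.mem_iUnion, Set.mem_iInter, Set.mem_prod, Sigma03Normal, take_initSeg_eq_iff,
      exists_prop]
    refine exists_congr fun x => forall_congr' fun y => ?_
    constructor
    · rintro ⟨σ, τ, hστ, hA, hB⟩
      obtain ⟨k, hk⟩ := (hWR _).1 hστ
      let s := Nat.pair (Encodable.encode ((σ, τ), k)) (σ.length + τ.length)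
      have hs : σ.length + τ.length ≤ s := Nat.right_le_pair _ _
      have hws : w (initSeg A s) = ((σ, τ), k) := by
        simp only [w, initSeg_length, s, Nat.unpair_pair, Encodable.encodek, Option.getD_some]
      refine ⟨s, ?_⟩
      rw [hws]
      exact ⟨⟨hA, by simp only; omega⟩, ⟨hB, by simp only; omega⟩, hk⟩
    · rintro ⟨s, ⟨hA, -⟩, ⟨hB, -⟩, hk⟩
      exact ⟨_, _, (hWR _).2 ⟨_, hk⟩, hA, hB⟩

theorem PrimrecPred.isSigma03Set {V : (ℕ × ℕ) × (List Bool × List Bool) → Prop}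
    (hV : PrimrecPred V) : IsSigma03Set {p | Sigma03Normal V p.1 p.2} := by
  classical
  refine ⟨fun q => q.2.1.length = q.2.2.length ∧ V q, ?_, ?_⟩
  · have h : PrimrecPred fun q : (ℕ × ℕ) × (List Bool × List Bool) =>
        q.2.1.length = q.2.2.length ∧ V q :=
      (Primrec.eq.comp (Primrec.list_length.comp (Primrec.fst.comp Primrec.snd))
        (Primrec.list_length.comp (Primrec.snd.comp Primrec.snd))).and hV
    exact ComputablePred.to_re ⟨_, h.decide.to_comp⟩
  · ext ⟨A, B⟩
    simp only [Set.mem_ofPred_eq, Set.mem_iUnion, Set.mem_iInter, Set.mem_prod, Sigma03Normal,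
      exists_prop]
    refine exists_congr fun x => forall_congr' fun y => ?_
    constructor
    · rintro ⟨s, hs⟩
      exact ⟨initSeg A s, initSeg B s, ⟨by simp, hs⟩, (mem_binaryCylinder_iff _ _).2 (by simp),
        (mem_binaryCylinder_iff _ _).2 (by simp)⟩
    · rintro ⟨σ, τ, ⟨hl, hV⟩, hA, hB⟩
      rw [mem_binaryCylinder_iff] at hA hB
      rw [← hl] at hB
      exact ⟨σ.length, by rwa [← hA, ← hB]⟩

/-! ### Coding an equivalence relation into sets modulo finite differences -/

/-- A guess about the first `b` instances of an equivalence relation `E`, given as a list of length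
`b` with two Boolean columns: the first column guesses, for each `t = ⟨i, j, x⟩ < b`, whether `x`
witnesses `E i j`; the second column is the part below `b` of a guessed equivalence class. -/
abbrev EquivGuess : Type := List (Bool × Bool)

namespace EquivGuess

/-- The guess whether the triple coded by `t` is a witness; `false` out of range. -/
def wit (L : EquivGuess) (t : ℕ) : Bool := (L.getD t (false, false)).1

/-- The guess whether `i` is in the equivalence class; `false` out of range. -/
def cls (L : EquivGuess) (i : ℕ) : Bool := (L.getD i (false, false)).2

/-- The guessed class is closed under the guessed witnesses. -/
def Consistent (L : EquivGuess) : Prop :=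
  ∀ t < L.length, L.wit t = true → L.cls t.unpair.1 = L.cls t.unpair.2.unpair.1

/-- Some triple that `L` guesses not to be a witness reaches the level `v`, where `w t v` expresses
that the triple `t` reaches the level `v`. -/
def Reaches (w : ℕ → ℕ → Prop) (L : EquivGuess) (v : ℕ) : Prop :=
  ∃ t < L.length, L.wit t = false ∧ w t v

/-- The pair of a guess and a level with code `n`; numbers that code no pair stand for the empty
guess. -/
def ofCode (n : ℕ) : EquivGuess × ℕ := (Encodable.decode₂ (EquivGuess × ℕ) n).getD ([], 0)

/-- The number `n`, coding a guess `L` and a level `v`, is enumerated into the set with index `i`: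
either some triple deemed not to be a witness gets beyond level `v`, and then `n` goes into all
sets, or some such triple gets to level `v` and `i` belongs to the guessed class. -/
def Enum (w : ℕ → ℕ → Prop) (i n : ℕ) : Prop :=
  (ofCode n).1.Consistent ∧ ((ofCode n).1.Reaches w ((ofCode n).2 + 1) ∨
    ((ofCode n).1.cls i = true ∧ ((ofCode n).2 = 0 ∨ (ofCode n).1.Reaches w (ofCode n).2)))

theorem Reaches.mono {w w' : ℕ → ℕ → Prop} (h : ∀ t v, w t v → w' t v) {L : EquivGuess} {v : ℕ}
    (hL : L.Reaches w v) : L.Reaches w' v :=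
  let ⟨t, ht, hf, hw⟩ := hL
  ⟨t, ht, hf, h t v hw⟩

theorem Enum.mono {w w' : ℕ → ℕ → Prop} (h : ∀ t v, w t v → w' t v) {i n : ℕ}
    (hn : Enum w i n) : Enum w' i n :=
  ⟨hn.1, hn.2.imp (Reaches.mono h) (And.imp_right (Or.imp_right (Reaches.mono h)))⟩

theorem enum_iff_exists {w : ℕ → ℕ → ℕ → Prop} {i n : ℕ} :
    Enum (fun t v => ∃ u, w u t v) i n ↔ ∃ u, Enum (w u) i n := by
  constructor
  · rintro ⟨hc, ⟨t, ht, hf, u, hu⟩ | ⟨hi, h0 | ⟨t, ht, hf, u, hu⟩⟩⟩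
    · exact ⟨u, hc, Or.inl ⟨t, ht, hf, hu⟩⟩
    · exact ⟨0, hc, Or.inr ⟨hi, Or.inl h0⟩⟩
    · exact ⟨u, hc, Or.inr ⟨hi, Or.inr ⟨t, ht, hf, hu⟩⟩⟩
  · rintro ⟨u, hu⟩
    exact hu.mono fun t v h => ⟨u, h⟩

theorem ofCode_encode (L : EquivGuess) (v : ℕ) : ofCode (Encodable.encode (L, v)) = (L, v) := by
  rw [ofCode, Encodable.encodek₂, Option.getD_some]

theorem ofCode_injOn : Set.InjOn ofCode {n | (ofCode n).1 ≠ []} := by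
  have key : ∀ n, (ofCode n).1 ≠ [] → Encodable.encode (ofCode n) = n := by
    intro n hn
    unfold ofCode at hn ⊢
    cases h : Encodable.decode₂ (EquivGuess × ℕ) n with
    | none => simp [h] at hn
    | some a => exact Encodable.decode₂_eq_some.1 h
  intro m hm n hn h
  rw [← key m hm, ← key n hn, h]

theorem finite_symmDiff_enum {E w : ℕ → ℕ → Prop}
    (hw : ∀ t u v, u ≤ v → w t v → w t u)
    (hE : ∀ i j, E i j ↔ ∃ x, ∀ v, w (Nat.pair i (Nat.pair j x)) v)
    {i j : ℕ} (hij : E i j) :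
    (symmDiff {n | Enum w i n} {n | Enum w j n}).Finite := by
  obtain ⟨x, hx⟩ := (hE i j).1 hij
  set t := Nat.pair i (Nat.pair j x) with ht
  -- A guess that covers the witness `t` and distinguishes `i` from `j` goes into all sets or none.
  have hD : ∀ n ∈ symmDiff {n | Enum w i n} {n | Enum w j n},
      ((ofCode n).1.length ≤ t ∧ (ofCode n).1 ≠ []) ∧
        ¬ (ofCode n).1.Reaches w ((ofCode n).2 + 1) ∧
        ((ofCode n).2 = 0 ∨ (ofCode n).1.Reaches w (ofCode n).2) := by
    intro n hn
    have hn' : (Enum w i n ∧ ¬ Enum w j n) ∨ (Enum w j n ∧ ¬ Enum w i n) := hn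
    simp only [Enum] at hn'
    generalize ofCode n = p at hn' ⊢
    obtain ⟨L, v⟩ := p
    simp only at hn' ⊢
    refine ⟨⟨?_, ?_⟩, ?_, ?_⟩
    · by_contra! hlt
      have hc : L.Consistent := by tauto
      cases hf : L.wit t with
      | false =>
        have : ∀ v, L.Reaches w v := fun v => ⟨t, hlt, hf, hx v⟩
        have := this (v + 1)
        tauto
      | true =>
        have := hc t hlt hf
        simp only [ht, Nat.unpair_pair] at this
        rw [this] at hn'
        tauto
    · rintro rfl
      have h₁ : ∀ i, EquivGuess.cls [] i = false := fun i => rfl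
      have h₂ : ∀ v, ¬ EquivGuess.Reaches w [] v := by rintro v ⟨t, ht, -⟩; simp at ht
      simp [h₁, h₂] at hn'
    · tauto
    · tauto
  refine Set.Finite.of_injOn (f := fun n => (ofCode n).1) (t := {L | L.length ≤ t})
    (fun n hn => (hD n hn).1.1) ?_ (List.finite_length_le _ _)
  intro m hm n hn hmn
  refine ofCode_injOn (hD m hm).1.2 (hD n hn).1.2 (Prod.ext hmn ?_)
  obtain ⟨-, hm₁, hm₂⟩ := hD m hm
  obtain ⟨-, hn₁, hn₂⟩ := hD n hn
  simp only at hmn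
  rw [hmn] at hm₁ hm₂
  -- The level of an undecided code is the highest one reached, so it is determined by the guess.
  have anti : ∀ {L : EquivGuess} {u v : ℕ}, u ≤ v → L.Reaches w v → L.Reaches w u :=
    fun h ⟨t, ht, hf, hv⟩ => ⟨t, ht, hf, hw t _ _ h hv⟩
  by_contra hne
  rcases lt_or_gt_of_ne hne with h | h
  · exact hm₁ (anti h (hn₂.resolve_left (by omega)))
  · exact hn₁ (anti h (hm₂.resolve_left (by omega)))

theorem infinite_symmDiff_enum {E w : ℕ → ℕ → Prop}
    (hw : ∀ t u v, u ≤ v → w t v → w t u)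
    (hE : ∀ i j, E i j ↔ ∃ x, ∀ v, w (Nat.pair i (Nat.pair j x)) v)
    (hEq : Equivalence E) {i j : ℕ} (hij : ¬ E i j) :
    (symmDiff {n | Enum w i n} {n | Enum w j n}).Infinite := by
  classical
  -- The correct guess of length `b` about witnesses and about the class of `i`.
  let L : ℕ → EquivGuess := fun b =>
    (List.range b).map fun t => (decide (∀ v, w t v), decide (E i t))
  have hwit : ∀ b t, t < b → ((L b).wit t = true ↔ ∀ v, w t v) := by
    intro b t h
    simp [L, wit, h]
  have hcls : ∀ b t, t < b → ((L b).cls t = true ↔ E i t) := by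
    intro b t h
    simp [L, cls, h]
  have hlen : ∀ b, (L b).length = b := fun b => by simp [L]
  have hcons : ∀ b, (L b).Consistent := by
    intro b t ht hf
    rw [hlen] at ht
    have h₁ : t.unpair.1 < b := (Nat.unpair_left_le t).trans_lt ht
    have h₂ : t.unpair.2.unpair.1 < b :=
      ((Nat.unpair_left_le _).trans (Nat.unpair_right_le t)).trans_lt ht
    have hE' : E t.unpair.1 t.unpair.2.unpair.1 :=
      (hE _ _).2 ⟨t.unpair.2.unpair.2, by simpa using (hwit b t ht).1 hf⟩
    rw [Bool.eq_iff_iff, hcls b _ h₁, hcls b _ h₂]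
    exact ⟨fun h => hEq.trans h hE', fun h => hEq.trans h (hEq.symm hE')⟩
  have hbound : ∀ b, ∃ v, ¬ (L b).Reaches w v := by
    intro b
    have : ∀ t, ∃ v, t < b → (L b).wit t = false → ¬ w t v := by
      intro t
      by_cases h : ∀ v, w t v
      · exact ⟨0, fun htb hf => by simp [(hwit b t htb).2 h] at hf⟩
      · exact (not_forall.1 h).imp fun v hv _ _ => hv
    choose v hv using this
    refine ⟨(Finset.range b).sup v, fun ⟨t, ht, hf, h⟩ => ?_⟩
    rw [hlen] at ht
    exact hv t ht hf (hw t _ _ (Finset.le_sup (Finset.mem_range.2 ht)) h)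
  have hlevel : ∀ b, ∃ v, ¬ (L b).Reaches w (v + 1) ∧ (v = 0 ∨ (L b).Reaches w v) := by
    intro b
    by_cases h0 : (L b).Reaches w 1
    · have hs := Nat.find_spec (hbound b)
      have hm := fun m => Nat.find_min (hbound b) (m := m)
      generalize Nat.find (hbound b) = k at hs hm
      rcases k with _ | k
      · obtain ⟨t, ht, hf, h⟩ := h0
        exact absurd ⟨t, ht, hf, hw t _ _ zero_le_one h⟩ hs
      · exact ⟨k, hs, Or.inr (not_not.1 (hm k (Nat.lt_succ_self k)))⟩
    · exact ⟨0, h0, Or.inl rfl⟩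
  choose v hv₁ hv₂ using hlevel
  refine Set.infinite_of_injective_forall_mem
    (f := fun b => Encodable.encode (L (b + i + j + 1), v (b + i + j + 1))) ?_ ?_
  · intro a b hab
    have := congrArg (fun p => p.1.length) (Encodable.encode_injective hab)
    simp only [hlen] at this
    omega
  · intro b
    refine Or.inl (?_ : Enum w i _ ∧ ¬ Enum w j _)
    simp only [Enum, ofCode_encode]
    refine ⟨⟨hcons _, Or.inr ⟨(hcls _ _ (by omega)).2 (hEq.refl i), hv₂ _⟩⟩, ?_⟩
    rintro ⟨-, h | ⟨h, -⟩⟩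
    · exact hv₁ _ h
    · exact hij ((hcls _ _ (by omega)).1 h)

end EquivGuess

/-! ### Subgroups of the rationals given by sets of pairwise coprime denominators -/

open Nat in
/-- The product of the Fermat numbers with index in a finite set. -/
def fermatProd (F : Finset ℕ) : ℕ := ∏ n ∈ F, fermatNumber n

theorem fermatProd_pos (F : Finset ℕ) : 0 < fermatProd F :=
  Finset.prod_pos fun n _ => by unfold Nat.fermatNumber; positivity

theorem fermatProd_ne_zero (F : Finset ℕ) : (fermatProd F : ℚ) ≠ 0 :=
  Nat.cast_ne_zero.2 (fermatProd_pos F).ne'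

theorem fermatProd_dvd {F F' : Finset ℕ} (h : F ⊆ F') : fermatProd F ∣ fermatProd F' :=
  Finset.prod_dvd_prod_of_subset _ _ _ h

theorem exists_intCast_of_dvd {a b : ℕ} (h : a ∣ b) {q : ℚ} (hq : ∃ z : ℤ, (a : ℚ) * q = z) :
    ∃ z : ℤ, (b : ℚ) * q = z := by
  obtain ⟨c, rfl⟩ := h
  obtain ⟨z, hz⟩ := hq
  refine ⟨c * z, ?_⟩
  push_cast
  rw [← hz]
  ring

/-- The group of rationals with a denominator that is a product of distinct Fermat numbers with
index in `W`. As Fermat numbers are pairwise coprime, `1 / F n` is in the group only if `n ∈ W`. -/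
def fermatGroup (W : Set ℕ) : AddSubgroup ℚ where
  carrier := {q | ∃ F : Finset ℕ, ↑F ⊆ W ∧ ∃ z : ℤ, (fermatProd F : ℚ) * q = z}
  zero_mem' := ⟨∅, by simp, 0, by simp⟩
  neg_mem' := by
    rintro q ⟨F, hF, z, hz⟩
    exact ⟨F, hF, -z, by push_cast; rw [← hz]; ring⟩
  add_mem' := by
    rintro p q ⟨F, hF, hp⟩ ⟨G, hG, hq⟩
    refine ⟨F ∪ G, by simp [hF, hG], ?_⟩
    obtain ⟨y, hy⟩ := exists_intCast_of_dvd (fermatProd_dvd Finset.subset_union_left) hp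
    obtain ⟨z, hz⟩ := exists_intCast_of_dvd (fermatProd_dvd Finset.subset_union_right) hq
    exact ⟨y + z, by push_cast; rw [← hy, ← hz]; ring⟩

theorem mem_fermatGroup {W : Set ℕ} {q : ℚ} :
    q ∈ fermatGroup W ↔ ∃ F : Finset ℕ, ↑F ⊆ W ∧ ∃ z : ℤ, (fermatProd F : ℚ) * q = z := Iff.rfl

theorem intCast_mem_fermatGroup (W : Set ℕ) (z : ℤ) : (z : ℚ) ∈ fermatGroup W :=
  ⟨∅, by simp, z, by simp [fermatProd]⟩

theorem one_mem_fermatGroup (W : Set ℕ) : (1 : ℚ) ∈ fermatGroup W := by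
  exact_mod_cast intCast_mem_fermatGroup W 1

/-- Homomorphisms between groups of rationals are multiplications by a constant. -/
theorem fermatGroup_hom_apply {W V : Set ℕ} (f : fermatGroup W →+ fermatGroup V)
    (q : fermatGroup W) : (f q : ℚ) = f ⟨1, one_mem_fermatGroup W⟩ * q := by
  have h : (q : ℚ).den • q = (q : ℚ).num • (⟨1, one_mem_fermatGroup W⟩ : fermatGroup W) := by
    ext
    simp
  have h' := congrArg (fun g : fermatGroup V => (g : ℚ)) (congrArg f h)
  simp only [map_nsmul, map_zsmul, AddSubgroup.coe_nsmul, AddSubgroup.coe_zsmul, nsmul_eq_mul,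
    zsmul_eq_mul] at h'
  have hd : ((q : ℚ).den : ℚ) ≠ 0 := Nat.cast_ne_zero.2 (q : ℚ).den_ne_zero
  apply mul_left_cancel₀ hd
  rw [h', ← mul_assoc, mul_comm ((q : ℚ).den : ℚ), mul_assoc, Rat.den_mul_eq_num]
  ring

theorem finite_diff_of_fermatGroup_equiv {W V : Set ℕ} (f : fermatGroup W ≃+ fermatGroup V) :
    (W \ V).Finite := by
  set r : ℚ := (f ⟨1, one_mem_fermatGroup W⟩ : fermatGroup V).1 with hr
  have hr0 : r ≠ 0 := by
    intro h0
    have : f ⟨1, one_mem_fermatGroup W⟩ = 0 := Subtype.ext h0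
    rw [map_eq_zero_iff f f.injective] at this
    exact one_ne_zero (congrArg Subtype.val this)
  refine (Set.finite_le_nat r.num.natAbs).subset fun n hn => ?_
  have ha : ((n.fermatNumber : ℕ) : ℚ) ≠ 0 := by
    unfold Nat.fermatNumber; positivity
  have hmem : (1 / (n.fermatNumber : ℚ)) ∈ fermatGroup W :=
    ⟨{n}, by simpa using hn.1, 1, by simp [fermatProd, ha]⟩
  obtain ⟨F, hF, z, hz⟩ := mem_fermatGroup.1 (f ⟨_, hmem⟩).2
  rw [show (f ⟨_, hmem⟩ : ℚ) = _ from fermatGroup_hom_apply f.toAddMonoidHom ⟨_, hmem⟩] at hz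
  have hz' : (fermatProd F : ℚ) * r = z * n.fermatNumber := by
    rw [← hz]
    simp only [AddEquiv.toAddMonoidHom_eq_coe, AddMonoidHom.coe_coe, ← hr]
    field_simp
  have hz'' : (fermatProd F : ℤ) * r.num = z * r.den * n.fermatNumber := by
    have : (fermatProd F : ℚ) * r.num = z * r.den * n.fermatNumber := by
      rw [← Rat.mul_den_eq_num r, ← mul_assoc, hz']
      ring
    exact_mod_cast this
  have hcop : IsCoprime (n.fermatNumber : ℤ) (fermatProd F : ℤ) := by
    rw [Nat.isCoprime_iff_coprime]
    exact Nat.Coprime.prod_right fun m hm =>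
      Nat.coprime_fermatNumber_fermatNumber fun h => hn.2 (hF (h ▸ hm))
  have hdvd : (n.fermatNumber : ℤ) ∣ r.num :=
    hcop.dvd_of_dvd_mul_left (Dvd.intro_left _ hz''.symm)
  have hle := Nat.le_of_dvd (Int.natAbs_pos.2 (Rat.num_ne_zero.2 hr0)) (Int.natCast_dvd.1 hdvd)
  exact Nat.fermatNumber_strictMono.le_apply.trans hle

/-- Removing finitely many denominators does not change the isomorphism type. -/
theorem nonempty_fermatGroup_equiv_inter {W V : Set ℕ} (h : (W \ V).Finite) :
    Nonempty (fermatGroup W ≃+ fermatGroup (W ∩ V)) := by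
  set A := h.toFinset with hA
  have hA0 := fermatProd_ne_zero A
  have h₁ : ∀ q ∈ fermatGroup W, (fermatProd A : ℚ) * q ∈ fermatGroup (W ∩ V) := by
    rintro q ⟨F, hF, hq⟩
    refine ⟨F \ A, ?_, ?_⟩
    · intro n hn
      simp only [hA, Finset.coe_sdiff, Set.Finite.coe_toFinset, Set.mem_sdiff] at hn
      exact ⟨hF hn.1, by_contra fun hv => hn.2 ⟨hF hn.1, hv⟩⟩
    · obtain ⟨z, hz⟩ := exists_intCast_of_dvd
        (fermatProd_dvd (Finset.subset_union_left : F ⊆ F ∪ A)) hq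
      refine ⟨z, ?_⟩
      rw [← hz, ← mul_assoc, ← Nat.cast_mul, fermatProd, fermatProd, fermatProd,
        ← Finset.prod_union Finset.sdiff_disjoint, Finset.sdiff_union_self_eq_union]
  have h₂ : ∀ q ∈ fermatGroup (W ∩ V), (fermatProd A : ℚ)⁻¹ * q ∈ fermatGroup W := by
    rintro q ⟨F, hF, z, hq⟩
    refine ⟨F ∪ A, ?_, z, ?_⟩
    · intro n hn
      simp only [hA, Finset.coe_union, Set.Finite.coe_toFinset] at hn
      exact hn.elim (fun h => (hF h).1) fun h => h.1
    · have hd : Disjoint F A := Finset.disjoint_left.2 fun n hn hn' =>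
        ((Set.Finite.mem_toFinset h).1 hn').2 (hF hn).2
      rw [fermatProd, Finset.prod_union hd, Nat.cast_mul, ← hq]
      change (fermatProd F * fermatProd A : ℚ) * _ = _
      field_simp
  exact ⟨{ toFun := fun q => ⟨_, h₁ q q.2⟩
           invFun := fun q => ⟨_, h₂ q q.2⟩
           left_inv := fun q => Subtype.ext (by simp [hA0])
           right_inv := fun q => Subtype.ext (by simp [hA0])
           map_add' := fun p q => Subtype.ext (by simp [mul_add]) }⟩

theorem nonempty_fermatGroup_equiv_iff {W V : Set ℕ} :
    Nonempty (fermatGroup W ≃+ fermatGroup V) ↔ (symmDiff W V).Finite := by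
  rw [Set.symmDiff_def, Set.finite_union]
  constructor
  · rintro ⟨f⟩
    exact ⟨finite_diff_of_fermatGroup_equiv f, finite_diff_of_fermatGroup_equiv f.symm⟩
  · rintro ⟨h₁, h₂⟩
    obtain ⟨f⟩ := nonempty_fermatGroup_equiv_inter h₁
    obtain ⟨g⟩ := nonempty_fermatGroup_equiv_inter h₂
    rw [Set.inter_comm] at g
    exact ⟨f.trans g.symm⟩

theorem isAddTorsionFree_fermatGroup (W : Set ℕ) : IsAddTorsionFree (fermatGroup W) := inferInstance

theorem rank_fermatGroup (W : Set ℕ) : Module.rank ℤ (fermatGroup W) = 1 := by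
  apply le_antisymm
  · calc Module.rank ℤ (fermatGroup W)
        ≤ Module.rank ℤ ℚ := LinearMap.rank_le_of_injective
          (fermatGroup W).subtype.toIntLinearMap Subtype.val_injective
      _ = Module.rank ℚ ℚ := (IsFractionRing.rank_right_eq ℤ ℚ ℚ).symm
      _ = 1 := Module.rank_self ℚ
  · have : Nontrivial (fermatGroup W) :=
      ⟨0, ⟨1, one_mem_fermatGroup W⟩, fun h => zero_ne_one (congrArg Subtype.val h)⟩
    exact Cardinal.one_le_iff_pos.2 rank_pos

theorem infinite_fermatGroup (W : Set ℕ) : (fermatGroup W : Set ℚ).Infinite := 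
  Set.infinite_of_injective_forall_mem (f := fun z : ℤ => (z : ℚ)) Int.cast_injective
    (intCast_mem_fermatGroup W)

/-! ### Computable presentations of the groups of rationals -/

section Names

/-- The rational number named by `⟨n, ⟨m, d⟩⟩`, which is `(n - m) / (d + 1)`. -/
def nameVal (k : ℕ) : ℚ :=
  ((k.unpair.1 : ℚ) - k.unpair.2.unpair.1) / (k.unpair.2.unpair.2 + 1)

theorem exists_nameVal (q : ℚ) : ∃ k, nameVal k = q := by
  obtain ⟨n, m, hnm⟩ : ∃ n m : ℕ, q.num = n - m :=
    ⟨q.num.toNat, (-q.num).toNat, by omega⟩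
  refine ⟨Nat.pair n (Nat.pair m (q.den - 1)), ?_⟩
  have hd : ((q.den - 1 : ℕ) : ℚ) + 1 = q.den := by
    exact_mod_cast Nat.sub_add_cancel q.den_pos
  simp only [nameVal, Nat.unpair_pair, hd]
  have : ((n : ℚ) - m) = q.num := by rw [hnm]; push_cast; rfl
  rw [this, Rat.num_div_den]

/-- The sum of the numbers named by `k` and `l` is named by `m`, expressed in `ℕ`. -/
def NameAdd (k l m : ℕ) : Prop :=
  k.unpair.1 * (l.unpair.2.unpair.2 + 1) * (m.unpair.2.unpair.2 + 1) +
      l.unpair.1 * (k.unpair.2.unpair.2 + 1) * (m.unpair.2.unpair.2 + 1) +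
      m.unpair.2.unpair.1 * (k.unpair.2.unpair.2 + 1) * (l.unpair.2.unpair.2 + 1) =
    k.unpair.2.unpair.1 * (l.unpair.2.unpair.2 + 1) * (m.unpair.2.unpair.2 + 1) +
      l.unpair.2.unpair.1 * (k.unpair.2.unpair.2 + 1) * (m.unpair.2.unpair.2 + 1) +
      m.unpair.1 * (k.unpair.2.unpair.2 + 1) * (l.unpair.2.unpair.2 + 1)

theorem nameAdd_iff {k l m : ℕ} : NameAdd k l m ↔ nameVal k + nameVal l = nameVal m := by
  simp only [NameAdd, nameVal]
  generalize k.unpair.2.unpair.2 = d₁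
  generalize l.unpair.2.unpair.2 = d₂
  generalize m.unpair.2.unpair.2 = d₃
  have h₁ : (d₁ : ℚ) + 1 ≠ 0 := Nat.cast_add_one_ne_zero d₁
  have h₂ : (d₂ : ℚ) + 1 ≠ 0 := Nat.cast_add_one_ne_zero d₂
  have h₃ : (d₃ : ℚ) + 1 ≠ 0 := Nat.cast_add_one_ne_zero d₃
  rw [div_add_div _ _ h₁ h₂, div_eq_div_iff (mul_ne_zero h₁ h₂) h₃, ← Nat.cast_inj (R := ℚ)]
  push_cast
  constructor <;> intro h <;> linear_combination h

theorem nameVal_zero : nameVal 0 = 0 := by simp [nameVal]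

theorem nameAdd_zero_iff {k l : ℕ} : NameAdd k 0 l ↔ nameVal k = nameVal l := by
  rw [nameAdd_iff, nameVal_zero, add_zero]

theorem primrecPred_nameAdd {α : Type*} [Primcodable α] {f g h : α → ℕ} (hf : Primrec f)
    (hg : Primrec g) (hh : Primrec h) : PrimrecPred fun a => NameAdd (f a) (g a) (h a) := by
  have h₁ : ∀ {f : α → ℕ}, Primrec f → Primrec fun a => (f a).unpair.1 := fun hf =>
    Primrec.fst.comp (Primrec.unpair.comp hf)
  have h₂ : ∀ {f : α → ℕ}, Primrec f → Primrec fun a => (f a).unpair.2 := fun hf =>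
    Primrec.snd.comp (Primrec.unpair.comp hf)
  have hd : ∀ {f : α → ℕ}, Primrec f → Primrec fun a => (f a).unpair.2.unpair.2 + 1 := fun hf =>
    Primrec.succ.comp (h₂ (h₂ hf))
  have hm : ∀ {f g h : α → ℕ}, Primrec f → Primrec g → Primrec h →
      Primrec fun a => f a * g a * h a := fun hf hg hh =>
    Primrec.nat_mul.comp (Primrec.nat_mul.comp hf hg) hh
  exact Primrec.eq.comp
    (Primrec.nat_add.comp (Primrec.nat_add.comp (hm (h₁ hf) (hd hg) (hd hh))
      (hm (h₁ hg) (hd hf) (hd hh))) (hm (h₁ (h₂ hh)) (hd hf) (hd hg)))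
    (Primrec.nat_add.comp (Primrec.nat_add.comp (hm (h₁ (h₂ hf)) (hd hg) (hd hh))
      (hm (h₁ (h₂ hg)) (hd hf) (hd hh))) (hm (h₁ hh) (hd hf) (hd hg)))

theorem mod_eq_mod_iff_exists_intCast {N k : ℕ} :
    N * k.unpair.1 % (k.unpair.2.unpair.2 + 1) =
      N * k.unpair.2.unpair.1 % (k.unpair.2.unpair.2 + 1) ↔ ∃ z : ℤ, (N : ℚ) * nameVal k = z := by
  simp only [nameVal]
  generalize k.unpair.1 = n
  generalize k.unpair.2.unpair.1 = m
  generalize k.unpair.2.unpair.2 = d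
  have hd : (d : ℚ) + 1 ≠ 0 := Nat.cast_add_one_ne_zero d
  change Nat.ModEq (d + 1) (N * n) (N * m) ↔ _
  rw [Nat.ModEq.comm, Nat.modEq_iff_dvd]
  refine exists_congr fun z => ?_
  rw [← mul_div_assoc, div_eq_iff hd, ← Int.cast_inj (α := ℚ)]
  push_cast
  constructor <;> intro h <;> linear_combination h

end Names

section Presentation

/-- The set with index `i` enumerated, by the predicate `M`, along the initial segments of `X`. -/
def enumSet (M : (ℕ × ℕ) × List Bool → Prop) (X : CantorSeq) (i : ℕ) : Set ℕ :=
  {n | ∃ u, M ((i, n), initSeg X u)}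

variable (M : (ℕ × ℕ) × List Bool → Prop)

open Classical in
/-- The product of the denominators below `|σ|` that have been enumerated along `σ`. -/
noncomputable def stageDen (i : ℕ) (σ : List Bool) : ℕ :=
  ((List.range σ.length).map fun n =>
    if ∃ u < σ.length + 1, M ((i, n), σ.take u) then n.fermatNumber else 1).prod

/-- The number named by `k` has been found, along `σ`, to be in the group with index `i`. -/
def InStage (i k : ℕ) (σ : List Bool) : Prop :=
  stageDen M i σ * k.unpair.1 % (k.unpair.2.unpair.2 + 1) =
    stageDen M i σ * k.unpair.2.unpair.1 % (k.unpair.2.unpair.2 + 1)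

/-- For `S = ⟨k, u⟩`: the number `k` is the least name of a rational number, and the least `u`
such that this rational is found in the group along the initial segment of `σ` of length `u`. -/
def IsNewStage (i S : ℕ) (σ : List Bool) : Prop :=
  (∀ k < S.unpair.1, ¬ NameAdd k 0 S.unpair.1) ∧ InStage M i S.unpair.1 (σ.take S.unpair.2) ∧
    ∀ u < S.unpair.2, ¬ InStage M i S.unpair.1 (σ.take u)

open Classical in
/-- `S` is the new stage with number `a`; the elements of the presentation are these numbers. -/
def IsStageNumber (i a S : ℕ) (σ : List Bool) : Prop :=
  IsNewStage M i S σ ∧ ((List.range S).filter fun T => IsNewStage M i T σ).length = a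

/-- The stages `Sa`, `Sb`, `Sc` present the elements `a`, `b`, `c` of the group with index `i`,
where `N = ⟨i, ⟨a, b, c⟩⟩`. -/
def ArePresented (N Sa Sb Sc : ℕ) (σ : List Bool) : Prop :=
  IsStageNumber M N.unpair.1 N.unpair.2.unpair.1 Sa σ ∧
    IsStageNumber M N.unpair.1 N.unpair.2.unpair.2.unpair.1 Sb σ ∧
    IsStageNumber M N.unpair.1 N.unpair.2.unpair.2.unpair.2 Sc σ

open Classical in
/-- The value at `N` of the join of the atomic diagrams, if `σ` is long enough to tell. -/
noncomputable def diagramAlong (N : ℕ) (σ : List Bool) : Option ℕ :=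
  if ∃ Sa < σ.length, ∃ Sb < σ.length, ∃ Sc < σ.length, ArePresented M N Sa Sb Sc σ ∧
    NameAdd Sa.unpair.1 Sb.unpair.1 Sc.unpair.1 then some 1
  else if ∃ Sa < σ.length, ∃ Sb < σ.length, ∃ Sc < σ.length, ArePresented M N Sa Sb Sc σ ∧
    ¬ NameAdd Sa.unpair.1 Sb.unpair.1 Sc.unpair.1 then some 0
  else none

end Presentation

section PresentationComputable

variable {M : (ℕ × ℕ) × List Bool → Prop} {α : Type*} [Primcodable α]

theorem primrec_fermatNumber : Primrec Nat.fermatNumber :=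
  have hpow : Primrec₂ ((· ^ ·) : ℕ → ℕ → ℕ) := Primrec₂.unpaired'.1 Nat.Primrec.pow
  Primrec.succ.comp (hpow.comp (Primrec.const 2) (hpow.comp (Primrec.const 2) Primrec.id))

theorem primrec_stageDen (hM : PrimrecPred M) {f : α → ℕ} {s : α → List Bool} (hf : Primrec f)
    (hs : Primrec s) : Primrec fun a => stageDen M (f a) (s a) := by
  classical
  have hmap : Primrec fun a => (List.range (s a).length).map fun n =>
      if ∃ u < (s a).length + 1, M ((f a, n), (s a).take u) then n.fermatNumber else 1 := by
    refine Primrec.list_map (Primrec.list_range.comp (Primrec.list_length.comp hs))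
      (Primrec.ite (PrimrecPred.bex_lt (p := fun (q : α × ℕ) u => M ((f q.1, q.2), (s q.1).take u))
        (Primrec.succ.comp (Primrec.list_length.comp (hs.comp Primrec.fst))) ?_)
        (primrec_fermatNumber.comp Primrec.snd) (Primrec.const 1))
    exact hM.comp (((hf.comp (Primrec.fst.comp Primrec.fst)).pair
      (Primrec.snd.comp Primrec.fst)).pair (Primrec.list_take.comp Primrec.snd
        (hs.comp (Primrec.fst.comp Primrec.fst))))
  refine (Primrec.list_foldr (h := fun _ p => p.1 * p.2) hmap (Primrec.const 1) ?_).of_eq fun a => ?_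
  · exact (Primrec.nat_mul.comp (Primrec.fst.comp Primrec.snd)
      (Primrec.snd.comp Primrec.snd)).to₂
  · rw [stageDen, List.prod_eq_foldr]

theorem primrecPred_inStage (hM : PrimrecPred M) {f k : α → ℕ} {s : α → List Bool}
    (hf : Primrec f) (hk : Primrec k) (hs : Primrec s) :
    PrimrecPred fun a => InStage M (f a) (k a) (s a) := by
  have h₂ := Primrec.unpair.comp (Primrec.snd.comp (Primrec.unpair.comp hk))
  have hd := Primrec.succ.comp (Primrec.snd.comp h₂)
  have hN := primrec_stageDen hM hf hs
  exact Primrec.eq.comp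
    (Primrec.nat_mod.comp (Primrec.nat_mul.comp hN (Primrec.fst.comp (Primrec.unpair.comp hk))) hd)
    (Primrec.nat_mod.comp (Primrec.nat_mul.comp hN (Primrec.fst.comp h₂)) hd)

theorem primrecPred_isNewStage (hM : PrimrecPred M) {f S : α → ℕ} {s : α → List Bool}
    (hf : Primrec f) (hS : Primrec S) (hs : Primrec s) :
    PrimrecPred fun a => IsNewStage M (f a) (S a) (s a) := by
  have hk := Primrec.fst.comp (Primrec.unpair.comp hS)
  have hu := Primrec.snd.comp (Primrec.unpair.comp hS)
  refine (PrimrecPred.ball_lt hk ?_).and ((primrecPred_inStage hM hf hk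
    (Primrec.list_take.comp hu hs)).and (PrimrecPred.ball_lt hu ?_))
  · exact (primrecPred_nameAdd Primrec.snd (Primrec.const 0) (hk.comp Primrec.fst)).not
  · exact (primrecPred_inStage hM (hf.comp Primrec.fst) (hk.comp Primrec.fst)
      (Primrec.list_take.comp Primrec.snd (hs.comp Primrec.fst))).not

theorem primrecPred_isStageNumber (hM : PrimrecPred M) {f n S : α → ℕ} {s : α → List Bool}
    (hf : Primrec f) (hn : Primrec n) (hS : Primrec S) (hs : Primrec s) :
    PrimrecPred fun a => IsStageNumber M (f a) (n a) (S a) (s a) := by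
  classical
  refine (primrecPred_isNewStage hM hf hS hs).and (Primrec.eq.comp (Primrec.list_length.comp ?_) hn)
  have hR : PrimrecRel fun (T : ℕ) (a : α) => IsNewStage M (f a) T (s a) :=
    primrecPred_isNewStage hM (hf.comp Primrec.snd) Primrec.fst (hs.comp Primrec.snd)
  exact (hR.listFilter.comp (Primrec.list_range.comp hS) Primrec.id).of_eq fun a => by
    simp only [id]

theorem computable_diagramAlong (hM : PrimrecPred M) : Computable₂ (diagramAlong M) := by
  classical
  have hP : PrimrecPred fun q : (((ℕ × List Bool) × ℕ) × ℕ) × ℕ =>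
      ArePresented M q.1.1.1.1 q.1.1.2 q.1.2 q.2 q.1.1.1.2 := by
    have hN : Primrec fun q : (((ℕ × List Bool) × ℕ) × ℕ) × ℕ => q.1.1.1.1 :=
      Primrec.fst.comp (Primrec.fst.comp (Primrec.fst.comp Primrec.fst))
    have hσ : Primrec fun q : (((ℕ × List Bool) × ℕ) × ℕ) × ℕ => q.1.1.1.2 :=
      Primrec.snd.comp (Primrec.fst.comp (Primrec.fst.comp Primrec.fst))
    have hi := Primrec.fst.comp (Primrec.unpair.comp hN)
    have h₁ := Primrec.unpair.comp (Primrec.snd.comp (Primrec.unpair.comp hN))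
    have h₂ := Primrec.unpair.comp (Primrec.snd.comp h₁)
    exact (primrecPred_isStageNumber hM hi (Primrec.fst.comp h₁)
      (Primrec.snd.comp (Primrec.fst.comp Primrec.fst)) hσ).and
      ((primrecPred_isStageNumber hM hi (Primrec.fst.comp h₂)
        (Primrec.snd.comp Primrec.fst) hσ).and
      (primrecPred_isStageNumber hM hi (Primrec.snd.comp h₂) Primrec.snd hσ))
  have hA : PrimrecPred fun q : (((ℕ × List Bool) × ℕ) × ℕ) × ℕ =>
      NameAdd q.1.1.2.unpair.1 q.1.2.unpair.1 q.2.unpair.1 :=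
    primrecPred_nameAdd
      (Primrec.fst.comp (Primrec.unpair.comp (Primrec.snd.comp (Primrec.fst.comp Primrec.fst))))
      (Primrec.fst.comp (Primrec.unpair.comp (Primrec.snd.comp Primrec.fst)))
      (Primrec.fst.comp (Primrec.unpair.comp Primrec.snd))
  have hl : Primrec fun q : ℕ × List Bool => q.2.length := Primrec.list_length.comp Primrec.snd
  have hex : ∀ {Q : (((ℕ × List Bool) × ℕ) × ℕ) × ℕ → Prop}, PrimrecPred Q →
      PrimrecPred fun q : ℕ × List Bool => ∃ Sa < q.2.length, ∃ Sb < q.2.length,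
        ∃ Sc < q.2.length, Q (((q, Sa), Sb), Sc) := fun hQ =>
    PrimrecPred.bex_lt hl (PrimrecPred.bex_lt (hl.comp Primrec.fst)
      (PrimrecPred.bex_lt (hl.comp (Primrec.fst.comp Primrec.fst)) hQ))
  exact (Primrec.ite (hex (hP.and hA)) (Primrec.const (some 1))
    (Primrec.ite (hex (hP.and hA.not)) (Primrec.const (some 0)) (Primrec.const none))).to_comp

end PresentationComputable

section PresentationCorrect

variable {M : (ℕ × ℕ) × List Bool → Prop} {X : CantorSeq} {i : ℕ}

theorem stageDen_initSeg (u : ℕ) : ∃ F : Finset ℕ, stageDen M i (initSeg X u) = fermatProd F ∧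
    ∀ n, n ∈ F ↔ n < u ∧ ∃ v ≤ u, M ((i, n), initSeg X v) := by
  classical
  refine ⟨(Finset.range u).filter fun n => ∃ v ≤ u, M ((i, n), initSeg X v), ?_, by simp⟩
  rw [fermatProd, Finset.prod_filter, stageDen, initSeg_length]
  change _ = ((List.range u).map _).prod
  refine congrArg List.prod (List.map_congr_left fun n _ => ?_)
  refine if_congr (exists_congr fun v => ?_) rfl rfl
  rw [Nat.lt_succ_iff]
  exact and_congr_right fun h => by rw [take_initSeg X h]

theorem nameVal_mem_fermatGroup_iff {k : ℕ} :
    nameVal k ∈ fermatGroup (enumSet M X i) ↔ ∃ u, InStage M i k (initSeg X u) := by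
  simp only [InStage, mod_eq_mod_iff_exists_intCast]
  constructor
  · rintro ⟨F, hF, hz⟩
    have : ∀ n, ∃ v, n ∈ F → M ((i, n), initSeg X v) := fun n => by
      by_cases h : n ∈ F
      · exact (hF h).imp fun v hv _ => hv
      · exact ⟨0, fun h' => absurd h' h⟩
    choose v hv using this
    obtain ⟨F', hF', hmem⟩ := stageDen_initSeg (M := M) (X := X) (i := i) (F.sup fun n => n + 1 + v n)
    refine ⟨F.sup fun n => n + 1 + v n, exists_intCast_of_dvd ?_ hz⟩
    rw [hF']
    refine fermatProd_dvd fun n hn => (hmem n).2 ?_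
    have := Finset.le_sup (f := fun n => n + 1 + v n) hn
    exact ⟨by omega, v n, by omega, hv n hn⟩
  · rintro ⟨u, hz⟩
    obtain ⟨F, hF, hmem⟩ := stageDen_initSeg (M := M) (X := X) (i := i) u
    rw [hF] at hz
    exact ⟨F, fun n hn => let ⟨v, _, hv⟩ := ((hmem n).1 hn).2; ⟨v, hv⟩, hz⟩

/-- The stages that are new along `X`. -/
def NewStage (M : (ℕ × ℕ) × List Bool → Prop) (X : CantorSeq) (i S : ℕ) : Prop :=
  IsNewStage M i S (initSeg X S)

theorem isNewStage_initSeg_iff {S s : ℕ} (h : S ≤ s) :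
    IsNewStage M i S (initSeg X s) ↔ NewStage M X i S := by
  have hu : ∀ u ≤ S.unpair.2, ∀ r, S ≤ r → (initSeg X r).take u = initSeg X u := fun u hu r hr =>
    take_initSeg X (hu.trans ((Nat.unpair_right_le S).trans hr))
  unfold NewStage IsNewStage
  rw [hu _ le_rfl s h, hu _ le_rfl S le_rfl]
  refine and_congr_right fun _ => and_congr_right fun _ => forall₂_congr fun u hlt => ?_
  rw [hu u hlt.le s h, hu u hlt.le S le_rfl]

open Classical in
theorem isStageNumber_initSeg_iff {a S s : ℕ} (h : S ≤ s) :
    IsStageNumber M i a S (initSeg X s) ↔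
      NewStage M X i S ∧ Nat.count (NewStage M X i) S = a := by
  rw [IsStageNumber, isNewStage_initSeg_iff h, Nat.count, List.countP_eq_length_filter]
  refine and_congr_right fun _ => ?_
  rw [List.filter_congr fun T hT => ?_]
  have := List.mem_range.1 hT
  simp only [isNewStage_initSeg_iff (M := M) (X := X) (i := i) (this.le.trans h)]

theorem NewStage.nameVal_mem {S : ℕ} (h : NewStage M X i S) :
    nameVal S.unpair.1 ∈ fermatGroup (enumSet M X i) :=
  nameVal_mem_fermatGroup_iff.2 ⟨S.unpair.2, by
    have := h.2.1
    rwa [take_initSeg X (Nat.unpair_right_le S)] at this⟩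

theorem NewStage.inj {S T : ℕ} (hS : NewStage M X i S) (hT : NewStage M X i T)
    (h : nameVal S.unpair.1 = nameVal T.unpair.1) : S = T := by
  have h₁ : S.unpair.1 = T.unpair.1 := by
    rcases lt_trichotomy S.unpair.1 T.unpair.1 with hlt | heq | hlt
    · exact absurd (nameAdd_zero_iff.2 h) (hT.1 _ hlt)
    · exact heq
    · exact absurd (nameAdd_zero_iff.2 h.symm) (hS.1 _ hlt)
  have key : ∀ {S T : ℕ}, NewStage M X i S → NewStage M X i T → S.unpair.1 = T.unpair.1 →
      ¬ S.unpair.2 < T.unpair.2 := by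
    intro S T hS hT h₁ hlt
    refine hT.2.2 _ hlt ?_
    have := hS.2.1
    rw [take_initSeg X (Nat.unpair_right_le S)] at this
    rwa [take_initSeg X (hlt.le.trans (Nat.unpair_right_le T)), ← h₁]
  have h₂ : S.unpair.2 = T.unpair.2 :=
    le_antisymm (not_lt.1 (key hT hS h₁.symm)) (not_lt.1 (key hS hT h₁))
  rw [← Nat.pair_unpair S, ← Nat.pair_unpair T, h₁, h₂]

theorem exists_newStage {q : ℚ} (hq : q ∈ fermatGroup (enumSet M X i)) :
    ∃ S, NewStage M X i S ∧ nameVal S.unpair.1 = q := by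
  classical
  have hk := exists_nameVal q
  have hkq := Nat.find_spec hk
  have hkmin := fun l => Nat.find_min hk (m := l)
  generalize Nat.find hk = k at hkq hkmin
  have hu := nameVal_mem_fermatGroup_iff.1 (hkq.symm ▸ hq)
  have huq := Nat.find_spec hu
  have humin := fun l => Nat.find_min hu (m := l)
  generalize Nat.find hu = u at huq humin
  have htake : ∀ v ≤ u, (initSeg X (Nat.pair k u)).take v = initSeg X v := fun v hv =>
    take_initSeg X (hv.trans (Nat.right_le_pair k u))
  refine ⟨Nat.pair k u, ⟨?_, ?_, ?_⟩, by simpa using hkq⟩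
  · intro l hl h
    simp only [Nat.unpair_pair] at hl h
    exact hkmin l hl ((nameAdd_zero_iff.1 h).trans hkq)
  · simpa only [Nat.unpair_pair, htake u le_rfl] using huq
  · intro v hv
    simp only [Nat.unpair_pair] at hv ⊢
    rw [htake v hv.le]
    exact humin v hv

open Classical in
/-- Numbering the new stages identifies the group with index `i` with `ω`. -/
theorem exists_equiv_stageNumber : ∃ e : fermatGroup (enumSet M X i) ≃ ℕ, ∀ a,
    ∃ S, ∀ T, (NewStage M X i T ∧ Nat.count (NewStage M X i) T = a ↔ T = S) ∧
      nameVal S.unpair.1 = e.symm a := by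
  choose st hst hval using fun q : fermatGroup (enumSet M X i) => exists_newStage q.2
  have hsurj : ∀ S, NewStage M X i S → ∃ q, st q = S := fun S hS =>
    ⟨⟨_, hS.nameVal_mem⟩, (hst _).inj hS (hval _)⟩
  have hinj : Function.Injective st := fun p q h => Subtype.ext (by rw [← hval p, ← hval q, h])
  have hinf : (Set.ofPred (NewStage M X i)).Infinite := by
    have : Infinite (fermatGroup (enumSet M X i)) := (infinite_fermatGroup _).to_subtype
    exact Set.infinite_of_injective_forall_mem hinj hst
  have hbij : Function.Bijective fun q => Nat.count (NewStage M X i) (st q) := by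
    constructor
    · exact fun p q h => hinj (Nat.count_injective (hst p) (hst q) h)
    · intro a
      obtain ⟨q, hq⟩ := hsurj _ (Nat.nth_mem_of_infinite hinf a)
      exact ⟨q, by simp only [hq]; exact Nat.count_nth_of_infinite hinf a⟩
  refine ⟨Equiv.ofBijective _ hbij, fun a => ⟨st ((Equiv.ofBijective _ hbij).symm a), fun T => ?_⟩⟩
  have ha := (Equiv.ofBijective _ hbij).apply_symm_apply a
  rw [Equiv.ofBijective_apply] at ha
  refine ⟨⟨fun ⟨hT, h⟩ => Nat.count_injective hT (hst _) (h.trans ha.symm), ?_⟩, hval _⟩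
  rintro rfl
  exact ⟨hst _, ha⟩

/-- Groups of rationals given by sets that are c.e. in an oracle, uniformly in an index, have
presentations with universe `ω` that are computable in the oracle, uniformly in the index. -/
theorem exists_oracleCode_presentation (hM : PrimrecPred M) :
    ∃ c : OracleCode, ∀ X : CantorSeq, ∃ Y : ℕ → CantorSeq,
      (∀ n, c.eval X n = Part.some (seqJoin Y n).toNat) ∧
      ∀ i, ∃ e : fermatGroup (enumSet M X i) ≃ ℕ, ∀ p q r,
        Y i (tripleIndex (e p) (e q) (e r)) = true ↔ p + q = r := by
  classical
  obtain ⟨c, hc⟩ := OracleCode.exists_eval_of_initSeg (computable_diagramAlong hM)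
  refine ⟨c, fun X => ?_⟩
  choose e S hS using fun i => exists_equiv_stageNumber (M := M) (X := X) (i := i)
  refine ⟨fun i t => decide ((e i).symm t.unpair.1 + (e i).symm t.unpair.2.unpair.1 =
    (e i).symm t.unpair.2.unpair.2), fun N => ?_, fun i => ⟨e i, fun p q r => by simp [tripleIndex]⟩⟩
  set i := N.unpair.1
  set a := N.unpair.2.unpair.1
  set b := N.unpair.2.unpair.2.unpair.1
  set d := N.unpair.2.unpair.2.unpair.2
  have hpres : ∀ s Sa Sb Sc, Sa < s → Sb < s → Sc < s →
      (ArePresented M N Sa Sb Sc (initSeg X s) ↔ Sa = S i a ∧ Sb = S i b ∧ Sc = S i d) := by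
    intro s Sa Sb Sc h₁ h₂ h₃
    rw [ArePresented, isStageNumber_initSeg_iff h₁.le, isStageNumber_initSeg_iff h₂.le,
      isStageNumber_initSeg_iff h₃.le, (hS _ _ _).1, (hS _ _ _).1, (hS _ _ _).1]
  have hadd : NameAdd (S i a).unpair.1 (S i b).unpair.1 (S i d).unpair.1 ↔
      (e i).symm a + (e i).symm b = (e i).symm d := by
    rw [nameAdd_iff, (hS i a 0).2, (hS i b 0).2, (hS i d 0).2, ← AddSubgroup.coe_add,
      Subtype.coe_inj]
  -- The bounded search succeeds as soon as the three stages are within reach.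
  have hsearch : ∀ s (Q : ℕ → ℕ → ℕ → Prop), (∃ Sa < s, ∃ Sb < s, ∃ Sc < s,
      ArePresented M N Sa Sb Sc (initSeg X s) ∧ Q Sa Sb Sc) ↔
      (S i a < s ∧ S i b < s ∧ S i d < s) ∧ Q (S i a) (S i b) (S i d) := by
    intro s Q
    constructor
    · rintro ⟨Sa, h₁, Sb, h₂, Sc, h₃, h, hQ⟩
      obtain ⟨rfl, rfl, rfl⟩ := (hpres s Sa Sb Sc h₁ h₂ h₃).1 h
      exact ⟨⟨h₁, h₂, h₃⟩, hQ⟩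
    · rintro ⟨⟨h₁, h₂, h₃⟩, hQ⟩
      exact ⟨_, h₁, _, h₂, _, h₃, (hpres s _ _ _ h₁ h₂ h₃).2 ⟨rfl, rfl, rfl⟩, hQ⟩
  have hdiag : ∀ s, diagramAlong M N (initSeg X s) =
      if S i a < s ∧ S i b < s ∧ S i d < s then
        some (if (e i).symm a + (e i).symm b = (e i).symm d then 1 else 0) else none := by
    intro s
    simp only [diagramAlong, initSeg_length]
    rw [if_congr (hsearch s fun Sa Sb Sc => NameAdd Sa.unpair.1 Sb.unpair.1 Sc.unpair.1) rfl rfl,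
      if_congr (hsearch s fun Sa Sb Sc => ¬ NameAdd Sa.unpair.1 Sb.unpair.1 Sc.unpair.1) rfl rfl,
      hadd]
    by_cases h₁ : S i a < s ∧ S i b < s ∧ S i d < s
    · by_cases h₂ : (e i).symm a + (e i).symm b = (e i).symm d
      · rw [if_pos ⟨h₁, h₂⟩, if_pos h₁, if_pos h₂]
      · rw [if_neg fun h => h₂ h.2, if_pos ⟨h₁, h₂⟩, if_pos h₁, if_neg h₂]
    · rw [if_neg fun h => h₁ h.1, if_neg fun h => h₁ h.1, if_neg h₁]
  have hval : (seqJoin (fun i t => decide ((e i).symm t.unpair.1 + (e i).symm t.unpair.2.unpair.1 =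
      (e i).symm t.unpair.2.unpair.2)) N).toNat =
      if (e i).symm a + (e i).symm b = (e i).symm d then 1 else 0 := by
    change (decide ((e i).symm a + (e i).symm b = (e i).symm d)).toNat = _
    by_cases h : (e i).symm a + (e i).symm b = (e i).symm d
    · rw [decide_eq_true h, if_pos h, Bool.toNat_true]
    · rw [decide_eq_false h, if_neg h, Bool.toNat_false]
  rw [hval]
  refine hc X N _ ⟨S i a + S i b + S i d + 1, ?_⟩ fun s => ?_
  · rw [hdiag, if_pos ⟨by omega, by omega, by omega⟩]
    exact Option.some_ne_none _
  · rw [hdiag]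
    by_cases h : S i a < s ∧ S i b < s ∧ S i d < s
    · exact Or.inr (if_pos h)
    · exact Or.inl (if_neg h)

end PresentationCorrect

/-! ### Reducing a `Σ⁰₃` equivalence relation to isomorphism of groups of rank one -/

section SeqRow

/-- The initial segment of length `s` of the `i`-th sequence, read off from an initial segment of
the join. -/
def seqRow (σ : List Bool) (i s : ℕ) : List Bool :=
  (List.range s).map fun p => σ.getD (Nat.pair i p) false

theorem seqRow_initSeg (A : ℕ → CantorSeq) {i s u : ℕ} (h : Nat.pair i s ≤ u) :
    seqRow (initSeg (seqJoin A) u) i s = initSeg (A i) s := by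
  refine List.map_congr_left fun p hp => ?_
  rw [initSeg_getD _ ((Nat.pair_lt_pair_right i (List.mem_range.1 hp)).trans_le h)]
  simp [seqJoin]

variable (V : (ℕ × ℕ) × (List Bool × List Bool) → Prop)

/-- For `t = ⟨i, j, x⟩`: the initial segment `σ` of the join shows that the innermost quantifier of
the normal form is satisfied by the sequences with index `i` and `j`, for the values `x` and `y` of
the outer ones. -/
def IsSettled (σ : List Bool) (t y : ℕ) : Prop :=
  ∃ s < σ.length + 1, Nat.pair t.unpair.1 s ≤ σ.length ∧
    Nat.pair t.unpair.2.unpair.1 s ≤ σ.length ∧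
    V ((t.unpair.2.unpair.2, y), (seqRow σ t.unpair.1 s, seqRow σ t.unpair.2.unpair.1 s))

theorem isSettled_initSeg_iff (A : ℕ → CantorSeq) (u t y : ℕ) :
    IsSettled V (initSeg (seqJoin A) u) t y ↔ ∃ s, Nat.pair t.unpair.1 s ≤ u ∧
      Nat.pair t.unpair.2.unpair.1 s ≤ u ∧ V ((t.unpair.2.unpair.2, y),
        (initSeg (A t.unpair.1) s, initSeg (A t.unpair.2.unpair.1) s)) := by
  simp only [IsSettled, initSeg_length]
  constructor
  · rintro ⟨s, -, h₁, h₂, h⟩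
    rw [seqRow_initSeg A h₁, seqRow_initSeg A h₂] at h
    exact ⟨s, h₁, h₂, h⟩
  · rintro ⟨s, h₁, h₂, h⟩
    refine ⟨s, Nat.lt_succ_of_le ((Nat.right_le_pair _ _).trans h₁), h₁, h₂, ?_⟩
    rwa [seqRow_initSeg A h₁, seqRow_initSeg A h₂]

theorem exists_forall_isSettled_iff (A : ℕ → CantorSeq) (t v : ℕ) :
    (∃ u, ∀ y < v, IsSettled V (initSeg (seqJoin A) u) t y) ↔
      ∀ y < v, ∃ s, V ((t.unpair.2.unpair.2, y),
        (initSeg (A t.unpair.1) s, initSeg (A t.unpair.2.unpair.1) s)) := by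
  simp only [isSettled_initSeg_iff]
  constructor
  · rintro ⟨u, hu⟩ y hy
    exact (hu y hy).imp fun s hs => hs.2.2
  · intro h
    have : ∀ y, ∃ s, y < v → V ((t.unpair.2.unpair.2, y),
        (initSeg (A t.unpair.1) s, initSeg (A t.unpair.2.unpair.1) s)) := fun y => by
      by_cases hy : y < v
      · exact (h y hy).imp fun s hs _ => hs
      · exact ⟨0, fun h' => absurd h' hy⟩
    choose s hs using this
    refine ⟨(Finset.range v).sup fun y =>
      Nat.pair t.unpair.1 (s y) + Nat.pair t.unpair.2.unpair.1 (s y), fun y hy => ?_⟩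
    have := Finset.le_sup (f := fun y =>
      Nat.pair t.unpair.1 (s y) + Nat.pair t.unpair.2.unpair.1 (s y)) (Finset.mem_range.2 hy)
    exact ⟨s y, by omega, by omega, hs y hy⟩

end SeqRow

section Computability

variable {V : (ℕ × ℕ) × (List Bool × List Bool) → Prop} {α : Type*} [Primcodable α]

theorem primrec_seqRow {s : α → List Bool} {f g : α → ℕ} (hs : Primrec s) (hf : Primrec f)
    (hg : Primrec g) : Primrec fun a => seqRow (s a) (f a) (g a) :=
  Primrec.list_map (Primrec.list_range.comp hg) ((Primrec.list_getD false).comp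
    (hs.comp Primrec.fst) (Primrec₂.natPair.comp (hf.comp Primrec.fst) Primrec.snd))

theorem primrecPred_isSettled (hV : PrimrecPred V) {s : α → List Bool} {t y : α → ℕ}
    (hs : Primrec s) (ht : Primrec t) (hy : Primrec y) :
    PrimrecPred fun a => IsSettled V (s a) (t a) (y a) := by
  have hl := (Primrec.list_length.comp hs)
  have hi := (Primrec.fst.comp (Primrec.unpair.comp ht)).comp (Primrec.fst (α := α) (β := ℕ))
  have h₂ := Primrec.unpair.comp (Primrec.snd.comp (Primrec.unpair.comp ht))
  have hj := (Primrec.fst.comp h₂).comp (Primrec.fst (α := α) (β := ℕ))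
  have hx := (Primrec.snd.comp h₂).comp (Primrec.fst (α := α) (β := ℕ))
  have hs' := hs.comp (Primrec.fst (α := α) (β := ℕ))
  refine PrimrecPred.bex_lt (Primrec.succ.comp hl) ?_
  exact (Primrec.nat_le.comp (Primrec₂.natPair.comp hi Primrec.snd) (hl.comp Primrec.fst)).and
    ((Primrec.nat_le.comp (Primrec₂.natPair.comp hj Primrec.snd) (hl.comp Primrec.fst)).and
    (hV.comp ((hx.pair (hy.comp Primrec.fst)).pair
      ((primrec_seqRow hs' hi Primrec.snd).pair (primrec_seqRow hs' hj Primrec.snd)))))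

namespace EquivGuess

theorem primrec_wit {L : α → EquivGuess} {t : α → ℕ} (hL : Primrec L) (ht : Primrec t) :
    Primrec fun a => (L a).wit (t a) :=
  Primrec.fst.comp ((Primrec.list_getD (false, false)).comp hL ht)

theorem primrec_cls {L : α → EquivGuess} {t : α → ℕ} (hL : Primrec L) (ht : Primrec t) :
    Primrec fun a => (L a).cls (t a) :=
  Primrec.snd.comp ((Primrec.list_getD (false, false)).comp hL ht)

theorem primrecPred_consistent {L : α → EquivGuess} (hL : Primrec L) :
    PrimrecPred fun a => (L a).Consistent := by
  have hL' := hL.comp (Primrec.fst (α := α) (β := ℕ))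
  have hu := Primrec.unpair.comp (Primrec.snd (α := α) (β := ℕ))
  exact PrimrecPred.ball_lt (Primrec.list_length.comp hL)
    ((Primrec.eq.comp (primrec_wit hL' Primrec.snd) (Primrec.const true)).imp
      (Primrec.eq.comp (primrec_cls hL' (Primrec.fst.comp hu))
        (primrec_cls hL' (Primrec.fst.comp (Primrec.unpair.comp (Primrec.snd.comp hu))))))

theorem primrecPred_reaches (hV : PrimrecPred V) {L : α → EquivGuess} {s : α → List Bool}
    {v : α → ℕ} (hL : Primrec L) (hs : Primrec s) (hv : Primrec v) :
    PrimrecPred fun a => (L a).Reaches (fun t v => ∀ y < v, IsSettled V (s a) t y) (v a) := by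
  refine PrimrecPred.bex_lt (Primrec.list_length.comp hL)
    ((Primrec.eq.comp (primrec_wit (hL.comp Primrec.fst) Primrec.snd) (Primrec.const false)).and
      (PrimrecPred.ball_lt (hv.comp Primrec.fst) ?_))
  exact primrecPred_isSettled hV (hs.comp (Primrec.fst.comp Primrec.fst))
    (Primrec.snd.comp Primrec.fst) Primrec.snd

theorem primrecPred_enum (hV : PrimrecPred V) : PrimrecPred fun q : (ℕ × ℕ) × List Bool =>
    Enum (fun t v => ∀ y < v, IsSettled V q.2 t y) q.1.1 q.1.2 := by
  have hc : Primrec fun q : (ℕ × ℕ) × List Bool => ofCode q.1.2 :=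
    Primrec.option_getD.comp (Primrec.decode₂.comp (Primrec.snd.comp Primrec.fst))
      (Primrec.const ([], 0))
  have hL := Primrec.fst.comp hc
  have hv := Primrec.snd.comp hc
  refine (primrecPred_consistent hL).and
    ((primrecPred_reaches hV hL Primrec.snd (Primrec.succ.comp hv)).or
      ((Primrec.eq.comp (primrec_cls hL (Primrec.fst.comp Primrec.fst)) (Primrec.const true)).and
        ((Primrec.eq.comp hv (Primrec.const 0)).or (primrecPred_reaches hV hL Primrec.snd hv))))

end EquivGuess

end Computability

/-- Isomorphism of structures with universe `ω` agrees with isomorphism of the groups presented. -/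
theorem tfabIso_iff {r : ℕ} {X Y : TFAbSpace r} {G H : Type} [AddCommGroup G] [AddCommGroup H]
    (e : G ≃ ℕ) (f : H ≃ ℕ)
    (he : ∀ a b c, X.1 (tripleIndex (e a) (e b) (e c)) = true ↔ a + b = c)
    (hf : ∀ a b c, Y.1 (tripleIndex (f a) (f b) (f c)) = true ↔ a + b = c) :
    TFAbIso r X Y ↔ Nonempty (G ≃+ H) := by
  constructor
  · rintro ⟨s, hs⟩
    refine ⟨{ toEquiv := e.trans (s.trans f.symm), map_add' := fun a b => ?_ }⟩
    have := (he a b (a + b)).2 rfl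
    rw [hs] at this
    have h := hf (f.symm (s (e a))) (f.symm (s (e b))) (f.symm (s (e (a + b))))
    simp only [Equiv.apply_symm_apply] at h
    exact (h.1 this).symm
  · rintro ⟨φ⟩
    refine ⟨e.symm.trans (φ.toEquiv.trans f), fun a b c => ?_⟩
    rw [Bool.eq_iff_iff]
    have h := he (e.symm a) (e.symm b) (e.symm c)
    simp only [Equiv.apply_symm_apply] at h
    simp only [Equiv.trans_apply, hf, h]
    change _ ↔ φ (e.symm a) + φ (e.symm b) = φ (e.symm c)
    rw [← map_add φ, φ.injective.eq_iff]

/-- A single program reduces every equivalence relation with the normal form `V` to isomorphism of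
torsion-free abelian groups of rank one. -/
theorem exists_oracleCode_reduction {V : (ℕ × ℕ) × (List Bool × List Bool) → Prop}
    (hV : PrimrecPred V) : ∃ c : OracleCode, ∀ (S : Set CantorSeq) (E : Setoid S),
      (∀ A B : S, E A B ↔ Sigma03Normal V A B) → ∃ g : (ℕ → S) → (ℕ → TFAbSpace 1),
        (∀ (A : ℕ → S) (n : ℕ), c.eval (seqJoin fun i => (A i : CantorSeq)) n =
          Part.some (seqJoin (fun i => (g A i : CantorSeq)) n).toNat) ∧
        IsCountableReduction E (TFAbIso 1) g := by
  obtain ⟨c, hc⟩ := exists_oracleCode_presentation (EquivGuess.primrecPred_enum hV)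
  refine ⟨c, fun S E hE => ?_⟩
  choose Y hY e he using fun A : ℕ → S => hc (seqJoin fun i => (A i : CantorSeq))
  refine ⟨fun A i => ⟨Y A i, _, inferInstance, e A i, isAddTorsionFree_fermatGroup _,
    by rw [rank_fermatGroup, Nat.cast_one], he A i⟩, fun A n => hY A n, fun A i j _ => ?_⟩
  rw [tfabIso_iff (e A i) (e A j) (he A i) (he A j), nonempty_fermatGroup_equiv_iff]
  set A' : ℕ → CantorSeq := fun i => (A i : CantorSeq)
  let w : ℕ → ℕ → Prop := fun t v => ∀ y < v, ∃ s, V ((t.unpair.2.unpair.2, y),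
    (initSeg (A' t.unpair.1) s, initSeg (A' t.unpair.2.unpair.1) s))
  have hset : ∀ i, enumSet (fun q => EquivGuess.Enum
      (fun t v => ∀ y < v, IsSettled V q.2 t y) q.1.1 q.1.2) (seqJoin A') i =
      {n | EquivGuess.Enum w i n} := by
    intro i
    ext n
    have h := EquivGuess.enum_iff_exists (i := i) (n := n)
      (w := fun u t v => ∀ y < v, IsSettled V (initSeg (seqJoin A') u) t y)
    simp only [exists_forall_isSettled_iff] at h
    exact h.symm
  have hw : ∀ t u v, u ≤ v → w t v → w t u := fun t u v huv h y hy => h y (hy.trans_le huv)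
  have hEw : ∀ i j, E (A i) (A j) ↔ ∃ x, ∀ v, w (Nat.pair i (Nat.pair j x)) v := by
    intro i j
    rw [hE]
    simp only [w, Nat.unpair_pair, Sigma03Normal]
    exact exists_congr fun x => ⟨fun h v y _ => h y, fun h y => h (y + 1) y y.lt_succ_self⟩
  rw [hset, hset]
  constructor
  · exact EquivGuess.finite_symmDiff_enum hw hEw
  · intro hfin
    by_contra hij
    exact EquivGuess.infinite_symmDiff_enum (E := fun i j => E (A i) (A j)) hw hEw
      ⟨fun i => E.refl _, fun h => E.symm h, fun h h' => E.trans h h'⟩ hij hfin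

/-! ### Structures with ternary graphs of binary operations -/

section TripleLift

/-- The action of a map of the universe on the indices of atomic sentences, for a language with `m`
ternary relation symbols in which `R_ρ(a, b, c)` has the index `m⟨a, b, c⟩ + ρ`. -/
def tripleLift (m : ℕ) (f : ℕ → ℕ) (t : ℕ) : ℕ :=
  m * tripleIndex (f (t / m).unpair.1) (f (t / m).unpair.2.unpair.1)
    (f (t / m).unpair.2.unpair.2) + t % m

theorem tripleLift_index {m ρ : ℕ} (hρ : ρ < m) (f : ℕ → ℕ) (a b c : ℕ) :
    tripleLift m f (m * tripleIndex a b c + ρ) = m * tripleIndex (f a) (f b) (f c) + ρ := by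
  have hm : 0 < m := by omega
  rw [tripleLift, Nat.mul_add_div hm, Nat.div_eq_of_lt hρ, Nat.mul_add_mod, Nat.mod_eq_of_lt hρ]
  simp [tripleIndex]

theorem tripleLift_comp {m : ℕ} (hm : 0 < m) (f g : ℕ → ℕ) (t : ℕ) :
    tripleLift m g (tripleLift m f t) = tripleLift m (g ∘ f) t := by
  conv_lhs => rw [tripleLift.eq_def m f]
  rw [tripleLift_index (Nat.mod_lt t hm), tripleLift]
  rfl

theorem tripleLift_id {m : ℕ} (t : ℕ) : tripleLift m id t = t := by
  simp [tripleLift, tripleIndex, Nat.div_add_mod]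

theorem tripleLift_congr {m : ℕ} {f g : ℕ → ℕ} {t : ℕ} (h : ∀ i ≤ t, f i = g i) :
    tripleLift m f t = tripleLift m g t := by
  have hq : t / m ≤ t := Nat.div_le_self t m
  have h₂ := Nat.unpair_right_le (t / m)
  rw [tripleLift, tripleLift, h _ ((Nat.unpair_left_le _).trans hq),
    h _ ((Nat.unpair_left_le _).trans (h₂.trans hq)),
    h _ ((Nat.unpair_right_le _).trans (h₂.trans hq))]

end TripleLift

section Structures

/-- `X` is the atomic diagram of the structure with universe `ω` and the operations `op ρ`, for
`ρ < m`, in the language of their graphs. -/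
def IsOpDiagram (m : ℕ) (op : ℕ → ℕ → ℕ → ℕ) (X : CantorSeq) : Prop :=
  ∀ ρ < m, ∀ a b c, X (m * tripleIndex a b c + ρ) = true ↔ op ρ a b = c

/-- The unary polynomial functions of the structure with the operations `op ρ`, for `ρ < m`, with
constants from `C`. -/
inductive PolyFun (m : ℕ) (op : ℕ → ℕ → ℕ → ℕ) (C : Set ℕ) : (ℕ → ℕ) → Prop
  | const {c : ℕ} (hc : c ∈ C) : PolyFun m op C fun _ => c
  | id : PolyFun m op C fun y => y
  | op {ρ : ℕ} (hρ : ρ < m) {f g : ℕ → ℕ} (hf : PolyFun m op C f) (hg : PolyFun m op C g) :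
    PolyFun m op C fun y => op ρ (f y) (g y)

/-- `x` is a solution of an equation between polynomial functions with constants from `C` that not
all elements solve. -/
def IsAlgOver (m : ℕ) (op : ℕ → ℕ → ℕ → ℕ) (C : Set ℕ) (x : ℕ) : Prop :=
  ∃ f g, PolyFun m op C f ∧ PolyFun m op C g ∧ f x = g x ∧ f ≠ g

/-- The features that torsion-free abelian groups of finite rank share with fields of finite
transcendence degree: an equation in one unknown has finitely many solutions unless it is an
identity, and every element solves such an equation with constants from a fixed finite set. -/
structure IsFinitelyAlgebraic (m : ℕ) (op : ℕ → ℕ → ℕ → ℕ) : Prop where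
  pos : 0 < m
  cancel : ∀ a b c, op 0 a c = op 0 b c → a = b
  finite : ∀ f g, PolyFun m op Set.univ f → PolyFun m op Set.univ g → f ≠ g →
    {y | f y = g y}.Finite
  exists_gen : ∃ C : List ℕ, ∀ x, IsAlgOver m op {c | c ∈ C} x

variable {m : ℕ} {op op' : ℕ → ℕ → ℕ → ℕ} {X Y : CantorSeq}

theorem PolyFun.mono {C D : Set ℕ} (h : C ⊆ D) {f : ℕ → ℕ} (hf : PolyFun m op C f) :
    PolyFun m op D f := by
  induction hf with
  | const hc => exact .const (h hc)
  | id => exact .id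
  | op hρ _ _ ihf ihg => exact .op hρ ihf ihg

/-- An isomorphism carries algebraic elements to algebraic elements. -/
theorem IsAlgOver.map_perm {C : List ℕ} {x : ℕ} (h : IsAlgOver m op {c | c ∈ C} x)
    (s : Equiv.Perm ℕ) (hs : ∀ ρ < m, ∀ a b, s (op ρ a b) = op' ρ (s a) (s b)) :
    IsAlgOver m op' {c | c ∈ C.map s} (s x) := by
  have key : ∀ {f}, PolyFun m op {c | c ∈ C} f →
      PolyFun m op' {c | c ∈ C.map s} (fun y => s (f (s.symm y))) := by
    intro f hf
    induction hf with
    | const hc => exact .const (List.mem_map_of_mem hc)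
    | id => simpa using PolyFun.id
    | op hρ _ _ ihf ihg => simpa only [hs _ hρ] using PolyFun.op hρ ihf ihg
  obtain ⟨f, g, hf, hg, hx, hne⟩ := h
  refine ⟨_, _, key hf, key hg, by simp [hx], fun heq => hne (funext fun y => ?_)⟩
  have := congrFun heq (s y)
  simpa using this

/-- Maps that preserve more and more of the atomic diagram commute with the operations in the
limit. -/
theorem eventually_map_op (hX : IsOpDiagram m op X) (hY : IsOpDiagram m op' Y)
    {ι : Type*} {l : Filter ι} {F : ι → ℕ → ℕ} (hF : ∀ t, ∀ᶠ n in l, X t = Y (tripleLift m (F n) t))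
    {ρ : ℕ} (hρ : ρ < m) (a b : ℕ) : ∀ᶠ n in l, F n (op ρ a b) = op' ρ (F n a) (F n b) := by
  filter_upwards [hF (m * tripleIndex a b (op ρ a b) + ρ)] with n hn
  rw [(hX ρ hρ a b _).2 rfl, tripleLift_index hρ] at hn
  exact ((hY ρ hρ _ _ _).1 hn.symm).symm

theorem eventually_ne (hX : IsOpDiagram m op X) (hop : IsFinitelyAlgebraic m op)
    (hY : IsOpDiagram m op' Y) {ι : Type*} {l : Filter ι} {F : ι → ℕ → ℕ}
    (hF : ∀ t, ∀ᶠ n in l, X t = Y (tripleLift m (F n) t)) {a b : ℕ} (hab : a ≠ b) :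
    ∀ᶠ n in l, F n a ≠ F n b := by
  have hm := hop.pos
  filter_upwards [hF (m * tripleIndex b a (op 0 a a) + 0), eventually_map_op hX hY hF hm a a]
    with n hn hn' heq
  rw [tripleLift_index hm, heq] at hn
  have h₁ := (hY 0 hm (F n b) (F n b) (F n (op 0 a a))).2 (by rw [hn', heq])
  rw [h₁] at hn
  exact hab (hop.cancel a b a ((hX 0 hm b a _).1 hn).symm)

/-- Polynomial functions are carried along by maps that preserve more and more of the atomic
diagram. -/
theorem PolyFun.exists_eventually_map (hX : IsOpDiagram m op X) (hY : IsOpDiagram m op' Y)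
    {ι : Type*} {l : Filter ι} {F : ι → ℕ → ℕ} (hF : ∀ t, ∀ᶠ n in l, X t = Y (tripleLift m (F n) t))
    {C C' : List ℕ} (hC : ∀ n, C.map (F n) = C') {f : ℕ → ℕ} (hf : PolyFun m op {c | c ∈ C} f) :
    ∃ f', PolyFun m op' Set.univ f' ∧ ∀ y, ∀ᶠ n in l, F n (f y) = f' (F n y) := by
  induction hf with
  | @const c hc =>
    obtain ⟨k, hk, rfl⟩ := List.getElem_of_mem hc
    refine ⟨fun _ => C'.getD k 0, .const trivial, fun y => .of_forall fun n => ?_⟩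
    rw [← hC n]
    simp [hk]
  | id => exact ⟨_, .id, fun y => .of_forall fun n => rfl⟩
  | @op ρ hρ f g _ _ ihf ihg =>
    obtain ⟨f', hf', hf⟩ := ihf
    obtain ⟨g', hg', hg⟩ := ihg
    refine ⟨_, .op hρ hf' hg', fun y => ?_⟩
    filter_upwards [hf y, hg y, eventually_map_op hX hY hF hρ (f y) (g y)] with n h₁ h₂ h₃
    rw [h₃, h₁, h₂]

/-- A compactness argument: if finite parts of the atomic diagram can be embedded over fixed images
of the parameters `C`, then so can the whole structure, since each element, being algebraic over
`C`, has finitely many possible images. The embedding is a limit along an ultrafilter. -/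
theorem exists_embedding (hX : IsOpDiagram m op X) (hop : IsFinitelyAlgebraic m op)
    (hY : IsOpDiagram m op' Y) (hop' : IsFinitelyAlgebraic m op') {C C' : List ℕ}
    (halg : ∀ x, IsAlgOver m op {c | c ∈ C} x)
    (hF : ∀ n, ∃ F : ℕ → ℕ, C.map F = C' ∧ ∀ t < n, X t = Y (tripleLift m F t)) :
    ∃ f : ℕ → ℕ, C.map f = C' ∧ ∀ t, X t = Y (tripleLift m f t) := by
  choose F hC hF using hF
  let U : Ultrafilter ℕ := Ultrafilter.of Filter.atTop
  have hFU : ∀ t, ∀ᶠ n in (U : Filter ℕ), X t = Y (tripleLift m (F n) t) := fun t =>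
    ((Filter.eventually_gt_atTop t).mono fun n hn => hF n t hn).filter_mono
      (Ultrafilter.of_le Filter.atTop)
  have hlim : ∀ x, ∃ y, ∀ᶠ n in (U : Filter ℕ), F n x = y := by
    intro x
    obtain ⟨f, g, hf, hg, hx, hne⟩ := halg x
    obtain ⟨x', hx'⟩ := Function.ne_iff.1 hne
    obtain ⟨f', hf', hff⟩ := hf.exists_eventually_map hX hY hFU hC
    obtain ⟨g', hg', hgg⟩ := hg.exists_eventually_map hX hY hFU hC
    have hne' : f' ≠ g' := by
      obtain ⟨n, h₁, h₂, h₃⟩ :=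
        ((hff x').and ((hgg x').and (eventually_ne hX hop hY hFU hx'))).exists
      rintro rfl
      exact h₃ (h₁.trans h₂.symm)
    have hfin := hop'.finite f' g' hf' hg' hne'
    obtain ⟨y, -, hy⟩ := (Ultrafilter.eventually_exists_mem_iff (f := U) hfin
      (P := fun y n => F n x = y)).1 (by
        filter_upwards [hff x, hgg x] with n h₁ h₂
        exact ⟨F n x, show f' _ = g' _ by rw [← h₁, ← h₂, hx], rfl⟩)
    exact ⟨y, hy⟩
  choose f hf using hlim
  refine ⟨f, ?_, fun t => ?_⟩
  · rw [← hC 0]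
    refine List.map_congr_left fun c hc => ?_
    obtain ⟨n, hn⟩ := (hf c).exists
    rw [← hn]
    exact List.map_inj_left.1 ((hC n).trans (hC 0).symm) c hc
  · obtain ⟨n, h₀, h₁, h₂, h₃⟩ := ((hFU t).and ((hf (t / m).unpair.1).and
      ((hf (t / m).unpair.2.unpair.1).and (hf (t / m).unpair.2.unpair.2)))).exists
    rw [h₀, tripleLift, h₁, h₂, h₃, tripleLift]

/-- A self-embedding that fixes parameters over which all elements are algebraic permutes the
finitely many solutions of each equation, so it is onto. -/
theorem surjective_of_selfEmbedding (hX : IsOpDiagram m op X) (hop : IsFinitelyAlgebraic m op)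
    {C : List ℕ} (halg : ∀ x, IsAlgOver m op {c | c ∈ C} x) {h : ℕ → ℕ} (hC : C.map h = C)
    (hh : ∀ t, X t = X (tripleLift m h t)) : Function.Surjective h := by
  have hh' : ∀ t, ∀ᶠ _ in (pure () : Filter Unit), X t = X (tripleLift m h t) := fun t => by
    simpa using hh t
  have hmap : ∀ ρ < m, ∀ a b, h (op ρ a b) = op ρ (h a) (h b) := fun ρ hρ a b => by
    simpa using eventually_map_op hX hX (F := fun _ => h) hh' hρ a b
  have hinj : Function.Injective h := fun a b hab => by
    by_contra hne
    exact absurd hab (by simpa using eventually_ne hX hop hX (F := fun _ => h) hh' hne)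
  have hfix : ∀ c ∈ C, h c = c := fun c hc =>
    List.map_inj_left.1 (hC.trans (List.map_id C).symm) c hc
  have hpoly : ∀ {f}, PolyFun m op {c | c ∈ C} f → ∀ y, h (f y) = f (h y) := by
    intro f hf y
    induction hf with
    | const hc => exact hfix _ hc
    | id => rfl
    | op hρ _ _ ihf ihg => rw [hmap _ hρ, ihf, ihg]
  intro x
  obtain ⟨f, g, hf, hg, hx, hne⟩ := halg x
  have hfin := hop.finite f g (hf.mono (Set.subset_univ _)) (hg.mono (Set.subset_univ _)) hne
  have hmaps : Set.MapsTo h {y | f y = g y} {y | f y = g y} := fun y hy => by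
    have hy : f y = g y := hy
    change f (h y) = g (h y)
    rw [← hpoly hf, ← hpoly hg, hy]
  obtain ⟨y, -, hy⟩ := ((hfin.injOn_iff_bijOn_of_mapsTo hmaps).1 hinj.injOn).surjOn hx
  exact ⟨y, hy⟩

/-- Isomorphism in terms of embeddings of finite parts over parameters. -/
theorem exists_perm_of_partial_embeddings (hX : IsOpDiagram m op X)
    (hop : IsFinitelyAlgebraic m op) (hY : IsOpDiagram m op' Y)
    (hop' : IsFinitelyAlgebraic m op') {C C' : List ℕ}
    (halg : ∀ x, IsAlgOver m op {c | c ∈ C} x) (halg' : ∀ x, IsAlgOver m op' {c | c ∈ C'} x)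
    (hF : ∀ n, ∃ F : ℕ → ℕ, C.map F = C' ∧ ∀ t < n, X t = Y (tripleLift m F t))
    (hG : ∀ n, ∃ G : ℕ → ℕ, C'.map G = C ∧ ∀ t < n, Y t = X (tripleLift m G t)) :
    ∃ s : Equiv.Perm ℕ, ∀ t, X t = Y (tripleLift m s t) := by
  have hm := hop.pos
  obtain ⟨f, hfC, hf⟩ := exists_embedding hX hop hY hop' halg hF
  obtain ⟨g, hgC, hg⟩ := exists_embedding hY hop' hX hop halg' hG
  have hsurj₂ : Function.Surjective (f ∘ g) := surjective_of_selfEmbedding hY hop' halg'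
    (by rw [← List.map_map, hgC, hfC]) fun t => by rw [← tripleLift_comp hm, ← hf, ← hg]
  have hinj : Function.Injective f := fun a b hab => by
    by_contra hne
    have := eventually_ne hX hop hY (l := (pure () : Filter Unit)) (F := fun _ => f)
      (fun t => by simpa using hf t) hne
    exact absurd hab (by simpa using this)
  exact ⟨Equiv.ofBijective f ⟨hinj, hsurj₂.of_comp⟩, hf⟩

end Structures

/-! ### Isomorphism of such structures in normal form -/

section Certificates

/-- The pair `p` can be put in front of the certificate `U`: it is a pair of equal parameters, or
the pair `(x, x')`, or it results from two earlier pairs by applying an operation in each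
coordinate, as attested by the part `σ` of the atomic diagram. -/
def CertStep (m : ℕ) (C : List ℕ) (z : ℕ × ℕ) (σ : List Bool) (p : ℕ × ℕ) (U : List (ℕ × ℕ)) :
    Prop :=
  (p.1 = p.2 ∧ ∃ c ∈ C, p.1 = c) ∨ p = z ∨ ∃ q ∈ U, ∃ r ∈ U, ∃ ρ < m,
    σ[m * tripleIndex q.1 r.1 p.1 + ρ]? = some true ∧
    σ[m * tripleIndex q.2 r.2 p.2 + ρ]? = some true

/-- A list of pairs `(f x, f x')` of values of polynomial functions, computed step by step from the
end of the list; here `z = (x, x')`. -/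
def IsCert (m : ℕ) (C : List ℕ) (z : ℕ × ℕ) (σ : List Bool) (U : List (ℕ × ℕ)) : Prop :=
  ∀ k < U.length, CertStep m C z σ (U.getD k (0, 0)) (U.drop (k + 1))

/-- The certificate `w = (x', U)` shows that `x` is algebraic over `C`: it computes two polynomial
functions that agree at `x` but not at `x'`. -/
def CertifiesAlg (m : ℕ) (C : List ℕ) (x : ℕ) (σ : List Bool) (w : ℕ × List (ℕ × ℕ)) : Prop :=
  IsCert m C (x, w.1) σ w.2 ∧ ∃ p ∈ w.2, ∃ q ∈ w.2, p.1 = q.1 ∧ p.2 ≠ q.2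

/-- The map with the list of values `F` takes the parameters `C` to `C'`, and preserves the first
`n` bits of the atomic diagram, as attested by the parts `σ` and `τ` of the diagrams. -/
def IsPartialEmbedding (m : ℕ) (C C' F : List ℕ) (n : ℕ) (σ τ : List Bool) : Prop :=
  C.map (fun i => F.getD i 0) = C' ∧
    ∀ t < n, σ[t]? ≠ none ∧ σ[t]? = τ[tripleLift m (fun i => F.getD i 0) t]?

theorem isCert_cons {m : ℕ} {C : List ℕ} {z : ℕ × ℕ} {σ : List Bool} {p : ℕ × ℕ}
    {U : List (ℕ × ℕ)} :
    IsCert m C z σ (p :: U) ↔ CertStep m C z σ p U ∧ IsCert m C z σ U := by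
  constructor
  · intro h
    refine ⟨by simpa using h 0 (by simp), fun k hk => ?_⟩
    simpa using h (k + 1) (by simpa using hk)
  · rintro ⟨h₀, h⟩ k hk
    rcases k with _ | k
    · simpa using h₀
    · simpa using h k (by simpa using hk)

variable {m : ℕ} {op op' : ℕ → ℕ → ℕ → ℕ} {X Y : CantorSeq} {C : List ℕ}

theorem IsCert.exists_polyFun (hX : IsOpDiagram m op X) {z : ℕ × ℕ} {s : ℕ} {U : List (ℕ × ℕ)}
    (hU : IsCert m C z (initSeg X s) U) :
    ∀ p ∈ U, ∃ f, PolyFun m op {c | c ∈ C} f ∧ f z.1 = p.1 ∧ f z.2 = p.2 := by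
  have hbit : ∀ {t}, (initSeg X s)[t]? = some true → X t = true := by
    intro t ht
    rw [initSeg_getElem?] at ht
    split_ifs at ht
    exact Option.some.inj ht
  induction U with
  | nil => simp
  | cons p U ih =>
    rw [isCert_cons] at hU
    have ih := ih hU.2
    intro p' hp'
    rcases List.mem_cons.1 hp' with rfl | hp'
    · rcases hU.1 with ⟨h, c, hc, hpc⟩ | rfl | ⟨q, hq, r, hr, ρ, hρ, h₁, h₂⟩
      · exact ⟨_, .const hc, hpc.symm, hpc.symm.trans h⟩
      · exact ⟨_, .id, rfl, rfl⟩
      · obtain ⟨f, hf, hf₁, hf₂⟩ := ih q hq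
        obtain ⟨g, hg, hg₁, hg₂⟩ := ih r hr
        refine ⟨_, .op hρ hf hg, ?_, ?_⟩
        · simp only [hf₁, hg₁]
          exact (hX ρ hρ _ _ _).1 (hbit h₁)
        · simp only [hf₂, hg₂]
          exact (hX ρ hρ _ _ _).1 (hbit h₂)
    · exact ih p' hp'

theorem CertifiesAlg.isAlgOver (hX : IsOpDiagram m op X) {x s : ℕ} {w : ℕ × List (ℕ × ℕ)}
    (h : CertifiesAlg m C x (initSeg X s) w) : IsAlgOver m op {c | c ∈ C} x := by
  obtain ⟨hU, p, hp, q, hq, h₁, h₂⟩ := h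
  obtain ⟨f, hf, hf₁, hf₂⟩ := hU.exists_polyFun hX p hp
  obtain ⟨g, hg, hg₁, hg₂⟩ := hU.exists_polyFun hX q hq
  refine ⟨f, g, hf, hg, by rw [hf₁, hg₁, h₁], fun heq => h₂ ?_⟩
  rw [← hf₂, ← hg₂, heq]

theorem eventually_initSeg_getElem? (X : CantorSeq) (t : ℕ) :
    ∀ᶠ s in Filter.atTop, (initSeg X s)[t]? = some (X t) :=
  (Filter.eventually_gt_atTop t).mono fun _ hs => initSeg_getElem?_of_lt X hs

theorem PolyFun.exists_isCert (hX : IsOpDiagram m op X) {z : ℕ × ℕ} {f : ℕ → ℕ}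
    (hf : PolyFun m op {c | c ∈ C} f) {U : List (ℕ × ℕ)}
    (hU : ∀ᶠ s in Filter.atTop, IsCert m C z (initSeg X s) U) :
    ∃ U', (∀ᶠ s in Filter.atTop, IsCert m C z (initSeg X s) U') ∧ U ⊆ U' ∧
      (f z.1, f z.2) ∈ U' := by
  induction hf generalizing U with
  | @const c hc =>
    refine ⟨(c, c) :: U, hU.mono fun s hs => isCert_cons.2 ⟨Or.inl ⟨rfl, c, hc, rfl⟩, hs⟩, ?_, ?_⟩
    · exact List.subset_cons_self _ _
    · exact List.mem_cons_self
  | id =>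
    refine ⟨z :: U, hU.mono fun s hs => isCert_cons.2 ⟨Or.inr (Or.inl rfl), hs⟩, ?_, ?_⟩
    · exact List.subset_cons_self _ _
    · exact List.mem_cons_self
  | @op ρ hρ f g _ _ ihf ihg =>
    obtain ⟨U₁, hU₁, hsub₁, hf⟩ := ihf hU
    obtain ⟨U₂, hU₂, hsub₂, hg⟩ := ihg hU₁
    refine ⟨(op ρ (f z.1) (g z.1), op ρ (f z.2) (g z.2)) :: U₂, ?_,
      fun p hp => List.mem_cons_of_mem _ (hsub₂ (hsub₁ hp)), List.mem_cons_self⟩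
    filter_upwards [hU₂, eventually_initSeg_getElem? X
      (m * tripleIndex (f z.1) (g z.1) (op ρ (f z.1) (g z.1)) + ρ), eventually_initSeg_getElem? X
      (m * tripleIndex (f z.2) (g z.2) (op ρ (f z.2) (g z.2)) + ρ)] with s h h₁ h₂
    refine isCert_cons.2 ⟨Or.inr (Or.inr ⟨_, hsub₂ hf, _, hg, ρ, hρ, ?_, ?_⟩), h⟩
    · rw [h₁, (hX ρ hρ _ _ _).2 rfl]
    · rw [h₂, (hX ρ hρ _ _ _).2 rfl]

theorem IsAlgOver.exists_certifiesAlg (hX : IsOpDiagram m op X) {x : ℕ}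
    (h : IsAlgOver m op {c | c ∈ C} x) :
    ∃ w, ∀ᶠ s in Filter.atTop, CertifiesAlg m C x (initSeg X s) w := by
  obtain ⟨f, g, hf, hg, hx, hne⟩ := h
  obtain ⟨x', hx'⟩ := Function.ne_iff.1 hne
  obtain ⟨U₁, hU₁, -, hmem₁⟩ := hf.exists_isCert hX (z := (x, x')) (U := [])
    (.of_forall fun s k hk => by simp at hk)
  obtain ⟨U₂, hU₂, hsub, hmem₂⟩ := hg.exists_isCert hX hU₁
  exact ⟨(x', U₂), hU₂.mono fun s hs => ⟨hs, _, hsub hmem₁, _, hmem₂, hx, hx'⟩⟩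

theorem exists_isPartialEmbedding {s : ℕ → ℕ} (hs : ∀ t, X t = Y (tripleLift m s t)) (C : List ℕ)
    (n : ℕ) : ∃ F, ∀ᶠ r in Filter.atTop,
      IsPartialEmbedding m C (C.map s) F n (initSeg X r) (initSeg Y r) := by
  let B := n + C.sum + 1
  let F := (List.range B).map s
  have hF : ∀ i < B, F.getD i 0 = s i := fun i hi => by simp [F, hi]
  have hC : C.map (fun i => F.getD i 0) = C.map s := List.map_congr_left fun c hc =>
    hF c (by have := List.le_sum_of_mem hc; omega)
  refine ⟨F, ?_⟩
  have : ∀ t ∈ Finset.range n, ∀ᶠ r in Filter.atTop, (initSeg X r)[t]? ≠ none ∧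
      (initSeg X r)[t]? = (initSeg Y r)[tripleLift m (fun i => F.getD i 0) t]? := by
    intro t ht
    have ht := Finset.mem_range.1 ht
    filter_upwards [eventually_initSeg_getElem? X t,
      eventually_initSeg_getElem? Y (tripleLift m s t)] with r h₁ h₂
    rw [tripleLift_congr (g := s) fun i hi => hF i (by omega), h₁, h₂, hs]
    exact ⟨Option.some_ne_none _, rfl⟩
  exact ((Filter.eventually_all_finset _).2 this).mono fun r hr =>
    ⟨hC, fun t ht => hr t (Finset.mem_range.2 ht)⟩

theorem IsPartialEmbedding.exists_map {C C' F : List ℕ} {n s : ℕ}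
    (h : IsPartialEmbedding m C C' F n (initSeg X s) (initSeg Y s)) :
    ∃ f : ℕ → ℕ, C.map f = C' ∧ ∀ t < n, X t = Y (tripleLift m f t) := by
  refine ⟨_, h.1, fun t ht => ?_⟩
  obtain ⟨h₁, h₂⟩ := h.2 t ht
  simp only [initSeg_getElem?] at h₁ h₂
  split_ifs at h₁ h₂ with h₃ h₄ <;> simp_all

end Certificates

section Matrix

/-- A pair of lists of parameters with a given code. -/
def paramsOfCode (x : ℕ) : List ℕ × List ℕ := (Encodable.decode x).getD ([], [])

/-- What has to be attested for each `n`: that `n` is algebraic over the parameters in both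
structures, and that the first `n` bits of each diagram embed into the other structure. -/
abbrev IsoCert : Type := ((ℕ × List (ℕ × ℕ)) × (ℕ × List (ℕ × ℕ))) × (List ℕ × List ℕ)

/-- The attestations are coded by the length of the initial segments of the diagrams. -/
def isoCertOf (σ : List Bool) : IsoCert :=
  (Encodable.decode σ.length.unpair.1).getD (((0, []), (0, [])), ([], []))

/-- The matrix of the normal form of isomorphism, for structures with `m` operations. -/
def isoMatrix (m : ℕ) (q : (ℕ × ℕ) × (List Bool × List Bool)) : Prop :=
  CertifiesAlg m (paramsOfCode q.1.1).1 q.1.2 q.2.1 (isoCertOf q.2.1).1.1 ∧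
  CertifiesAlg m (paramsOfCode q.1.1).2 q.1.2 q.2.2 (isoCertOf q.2.1).1.2 ∧
  IsPartialEmbedding m (paramsOfCode q.1.1).1 (paramsOfCode q.1.1).2 (isoCertOf q.2.1).2.1 q.1.2
    q.2.1 q.2.2 ∧
  IsPartialEmbedding m (paramsOfCode q.1.1).2 (paramsOfCode q.1.1).1 (isoCertOf q.2.1).2.2 q.1.2
    q.2.2 q.2.1

variable {α : Type*} [Primcodable α]

theorem primrec_tripleIndex {f g h : α → ℕ} (hf : Primrec f) (hg : Primrec g) (hh : Primrec h) :
    Primrec fun a => tripleIndex (f a) (g a) (h a) :=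
  Primrec₂.natPair.comp hf (Primrec₂.natPair.comp hg hh)

theorem primrecPred_certStep (m : ℕ) {C : α → List ℕ} {z p : α → ℕ × ℕ} {σ : α → List Bool}
    {U : α → List (ℕ × ℕ)} (hC : Primrec C) (hz : Primrec z) (hσ : Primrec σ) (hp : Primrec p)
    (hU : Primrec U) : PrimrecPred fun a => CertStep m (C a) (z a) (σ a) (p a) (U a) := by
  refine ((Primrec.eq.comp (Primrec.fst.comp hp) (Primrec.snd.comp hp)).and
    (PrimrecPred.bex_mem hC (Primrec.eq.comp (Primrec.fst.comp (hp.comp Primrec.fst))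
      Primrec.snd))).or ((Primrec.eq.comp hp hz).or (PrimrecPred.bex_mem hU
      (PrimrecPred.bex_mem (hU.comp Primrec.fst) (PrimrecPred.bex_lt (Primrec.const m) ?_))))
  have ha : Primrec fun b : ((α × (ℕ × ℕ)) × (ℕ × ℕ)) × ℕ => b.1.1.1 :=
    Primrec.fst.comp (Primrec.fst.comp Primrec.fst)
  have hq : Primrec fun b : ((α × (ℕ × ℕ)) × (ℕ × ℕ)) × ℕ => b.1.1.2 :=
    Primrec.snd.comp (Primrec.fst.comp Primrec.fst)
  have hr : Primrec fun b : ((α × (ℕ × ℕ)) × (ℕ × ℕ)) × ℕ => b.1.2 :=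
    Primrec.snd.comp Primrec.fst
  have hbit : ∀ {i j k : ((α × (ℕ × ℕ)) × (ℕ × ℕ)) × ℕ → ℕ}, Primrec i → Primrec j → Primrec k →
      PrimrecPred fun b => (σ b.1.1.1)[m * tripleIndex (i b) (j b) (k b) + b.2]? = some true :=
    fun hi hj hk => Primrec.eq.comp (Primrec.list_getElem?.comp (hσ.comp ha) (Primrec.nat_add.comp
      (Primrec.nat_mul.comp (Primrec.const m) (primrec_tripleIndex hi hj hk)) Primrec.snd))
      (Primrec.const (some true))
  exact (hbit (Primrec.fst.comp hq) (Primrec.fst.comp hr) (Primrec.fst.comp (hp.comp ha))).and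
    (hbit (Primrec.snd.comp hq) (Primrec.snd.comp hr) (Primrec.snd.comp (hp.comp ha)))

theorem primrecPred_certifiesAlg (m : ℕ) {C : α → List ℕ} {x : α → ℕ} {σ : α → List Bool}
    {w : α → ℕ × List (ℕ × ℕ)} (hC : Primrec C) (hx : Primrec x) (hσ : Primrec σ)
    (hw : Primrec w) : PrimrecPred fun a => CertifiesAlg m (C a) (x a) (σ a) (w a) := by
  have hU := Primrec.snd.comp hw
  refine (PrimrecPred.ball_lt (Primrec.list_length.comp hU) ?_).and
    (PrimrecPred.bex_mem hU (PrimrecPred.bex_mem (hU.comp Primrec.fst) ?_))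
  · have hU' := hU.comp (Primrec.fst (α := α) (β := ℕ))
    exact primrecPred_certStep m (hC.comp Primrec.fst)
      ((hx.pair (Primrec.fst.comp hw)).comp Primrec.fst) (hσ.comp Primrec.fst)
      ((Primrec.list_getD (0, 0)).comp hU' Primrec.snd)
      (Primrec.list_drop.comp (Primrec.succ.comp Primrec.snd) hU')
  · have hp : Primrec fun b : (α × (ℕ × ℕ)) × (ℕ × ℕ) => b.1.2 := Primrec.snd.comp Primrec.fst
    exact (Primrec.eq.comp (Primrec.fst.comp hp) (Primrec.fst.comp Primrec.snd)).and
      (Primrec.eq.comp (Primrec.snd.comp hp) (Primrec.snd.comp Primrec.snd)).not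

theorem primrecPred_isPartialEmbedding (m : ℕ) {C C' F : α → List ℕ} {n : α → ℕ}
    {σ τ : α → List Bool} (hC : Primrec C) (hC' : Primrec C') (hF : Primrec F) (hn : Primrec n)
    (hσ : Primrec σ) (hτ : Primrec τ) :
    PrimrecPred fun a => IsPartialEmbedding m (C a) (C' a) (F a) (n a) (σ a) (τ a) := by
  have hmap : Primrec₂ fun (a : α) (i : ℕ) => (F a).getD i 0 :=
    (Primrec.list_getD 0).comp (hF.comp Primrec.fst) Primrec.snd
  refine (Primrec.eq.comp (Primrec.list_map hC hmap) hC').and (PrimrecPred.ball_lt hn ?_)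
  have hbit : Primrec fun b : α × ℕ => (σ b.1)[b.2]? :=
    Primrec.list_getElem?.comp (hσ.comp Primrec.fst) Primrec.snd
  have hd : Primrec fun b : α × ℕ => (b.2 / m).unpair :=
    Primrec.unpair.comp (Primrec.nat_div.comp Primrec.snd (Primrec.const m))
  have hd' := Primrec.unpair.comp (Primrec.snd.comp hd)
  have hget : ∀ {i : α × ℕ → ℕ}, Primrec i → Primrec fun b => (F b.1).getD (i b) 0 := fun hi =>
    (Primrec.list_getD 0).comp (hF.comp Primrec.fst) hi
  have hlift : Primrec fun b : α × ℕ => tripleLift m (fun i => (F b.1).getD i 0) b.2 :=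
    Primrec.nat_add.comp (Primrec.nat_mul.comp (Primrec.const m) (primrec_tripleIndex
      (hget (Primrec.fst.comp hd)) (hget (Primrec.fst.comp hd')) (hget (Primrec.snd.comp hd'))))
      (Primrec.nat_mod.comp Primrec.snd (Primrec.const m))
  exact (Primrec.eq.comp hbit (Primrec.const none)).not.and
    (Primrec.eq.comp hbit (Primrec.list_getElem?.comp (hτ.comp Primrec.fst) hlift))

theorem primrecPred_isoMatrix (m : ℕ) : PrimrecPred (isoMatrix m) := by
  have hp : Primrec fun q : (ℕ × ℕ) × (List Bool × List Bool) => paramsOfCode q.1.1 :=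
    Primrec.option_getD.comp (Primrec.decode.comp (Primrec.fst.comp Primrec.fst))
      (Primrec.const ([], []))
  have hn : Primrec fun q : (ℕ × ℕ) × (List Bool × List Bool) => q.1.2 :=
    Primrec.snd.comp Primrec.fst
  have hσ : Primrec fun q : (ℕ × ℕ) × (List Bool × List Bool) => q.2.1 :=
    Primrec.fst.comp Primrec.snd
  have hτ : Primrec fun q : (ℕ × ℕ) × (List Bool × List Bool) => q.2.2 :=
    Primrec.snd.comp Primrec.snd
  have hw : Primrec fun q : (ℕ × ℕ) × (List Bool × List Bool) => isoCertOf q.2.1 :=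
    Primrec.option_getD.comp (Primrec.decode.comp (Primrec.fst.comp (Primrec.unpair.comp
      (Primrec.list_length.comp hσ)))) (Primrec.const (((0, []), (0, [])), ([], [])))
  have hp₁ := Primrec.fst.comp hp
  have hp₂ := Primrec.snd.comp hp
  exact (primrecPred_certifiesAlg m hp₁ hn hσ (Primrec.fst.comp (Primrec.fst.comp hw))).and
    ((primrecPred_certifiesAlg m hp₂ hn hτ (Primrec.snd.comp (Primrec.fst.comp hw))).and
    ((primrecPred_isPartialEmbedding m hp₁ hp₂ (Primrec.fst.comp (Primrec.snd.comp hw)) hn hσ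
      hτ).and (primrecPred_isPartialEmbedding m hp₂ hp₁ (Primrec.snd.comp (Primrec.snd.comp hw)) hn
      hτ hσ)))

/-- The normal form of isomorphism: there are parameters such that each `n` is algebraic over them
in both structures, and finite parts of each structure embed into the other one over them. -/
theorem exists_perm_iff_sigma03Normal {m : ℕ} {op op' : ℕ → ℕ → ℕ → ℕ} {X Y : CantorSeq}
    (hX : IsOpDiagram m op X) (hop : IsFinitelyAlgebraic m op) (hY : IsOpDiagram m op' Y)
    (hop' : IsFinitelyAlgebraic m op') :
    (∃ s : Equiv.Perm ℕ, ∀ t, X t = Y (tripleLift m s t)) ↔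
      Sigma03Normal (isoMatrix m) X Y := by
  constructor
  · rintro ⟨s, hs⟩
    have hm := hop.pos
    obtain ⟨C, hC⟩ := hop.exists_gen
    refine ⟨Encodable.encode (C, C.map s), fun n => ?_⟩
    have hs' : ∀ t, Y t = X (tripleLift m s.symm t) := fun t => by
      rw [hs, tripleLift_comp hm, Equiv.self_comp_symm, tripleLift_id]
    have hsop : ∀ ρ < m, ∀ a b, s (op ρ a b) = op' ρ (s a) (s b) := fun ρ hρ a b => by
      have := eventually_map_op hX hY (l := (pure () : Filter Unit)) (F := fun _ => s)
        (fun t => by simpa using hs t) hρ a b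
      simpa using this
    obtain ⟨w₁, h₁⟩ := (hC n).exists_certifiesAlg hX
    obtain ⟨w₂, h₂⟩ := ((hC (s.symm n)).map_perm s hsop).exists_certifiesAlg hY
    obtain ⟨F, h₃⟩ := exists_isPartialEmbedding hs C n
    obtain ⟨G, h₄⟩ := exists_isPartialEmbedding hs' (C.map s) n
    rw [s.apply_symm_apply] at h₂
    rw [List.map_map, Equiv.symm_comp_self, List.map_id] at h₄
    obtain ⟨N, hN⟩ := Filter.eventually_atTop.1 (h₁.and (h₂.and (h₃.and h₄)))
    let w : IsoCert := ((w₁, w₂), (F, G))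
    have hw : ∀ Z, isoCertOf (initSeg Z (Nat.pair (Encodable.encode w) N)) = w := fun Z => by
      rw [isoCertOf, initSeg_length, Nat.unpair_pair, Encodable.encodek, Option.getD_some]
    refine ⟨Nat.pair (Encodable.encode w) N, ?_⟩
    simp only [isoMatrix, paramsOfCode, Encodable.encodek, Option.getD_some, hw]
    exact hN _ (Nat.right_le_pair _ _)
  · rintro ⟨x, hx⟩
    choose s h₁ h₂ h₃ h₄ using hx
    exact exists_perm_of_partial_embeddings (C := (paramsOfCode x).1) (C' := (paramsOfCode x).2)
      hX hop hY hop' (fun n => (h₁ n).isAlgOver hX)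
      (fun n => (h₂ n).isAlgOver hY) (fun n => (h₃ n).exists_map) (fun n => (h₄ n).exists_map)

end Matrix

/-! ### Torsion-free abelian groups of finite rank -/

section Groups

variable {G : Type} [AddCommGroup G]

/-- The addition of a group, transported to `ω`. -/
def groupOp (e : G ≃ ℕ) (_ : ℕ) (a b : ℕ) : ℕ := e (e.symm a + e.symm b)

theorem PolyFun.exists_nsmul_add {e : G ≃ ℕ} {C : Set ℕ} {f : ℕ → ℕ}
    (hf : PolyFun 1 (groupOp e) C f) : ∃ (n : ℕ) (c : G), ∀ y, e.symm (f y) = n • e.symm y + c := by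
  induction hf with
  | @const c _ => exact ⟨0, e.symm c, by simp⟩
  | id => exact ⟨1, 0, by simp⟩
  | op _ _ _ ihf ihg =>
    obtain ⟨n, c, hf⟩ := ihf
    obtain ⟨k, d, hg⟩ := ihg
    refine ⟨n + k, c + d, fun y => ?_⟩
    simp only [groupOp, Equiv.symm_apply_apply, hf, hg, add_smul]
    abel

theorem finite_setOf_polyFun_eq_of_group [IsAddTorsionFree G] {e : G ≃ ℕ} {f g : ℕ → ℕ}
    (hf : PolyFun 1 (groupOp e) Set.univ f) (hg : PolyFun 1 (groupOp e) Set.univ g)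
    (hne : f ≠ g) : {y | f y = g y}.Finite := by
  obtain ⟨n, c, hf⟩ := hf.exists_nsmul_add
  obtain ⟨k, d, hg⟩ := hg.exists_nsmul_add
  have hnk : n = k → c ≠ d := by
    rintro rfl rfl
    exact hne (funext fun y => e.symm.injective (by rw [hf, hg]))
  refine Set.Subsingleton.finite fun y hy z hz => ?_
  have key : ∀ y, f y = g y → (n - k : ℤ) • e.symm y = d - c := by
    intro y hy
    have := congrArg e.symm hy
    rw [hf, hg] at this
    rw [sub_smul, natCast_zsmul, natCast_zsmul, sub_eq_sub_iff_add_eq_add, this, add_comm]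
  have hy := key y hy
  have hz := key z hz
  have hnk' : (n - k : ℤ) ≠ 0 := by
    intro h0
    rw [h0, zero_smul] at hy
    exact hnk (by omega) (sub_eq_zero.1 hy.symm).symm
  exact e.symm.injective (zsmul_right_injective hnk' (hy.trans hz.symm))

theorem polyFun_const_of_mem_closure {e : G ≃ ℕ} {s : Set G} {C : Set ℕ} (h0 : e 0 ∈ C)
    (hs : ∀ g ∈ s, e g ∈ C ∧ e (-g) ∈ C) {g : G} (hg : g ∈ AddSubgroup.closure s) :
    PolyFun 1 (groupOp e) C fun _ => e g := by
  have hadd : ∀ {a b : G}, PolyFun 1 (groupOp e) C (fun _ => e a) →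
      PolyFun 1 (groupOp e) C (fun _ => e b) → PolyFun 1 (groupOp e) C fun _ => e (a + b) := by
    intro a b ha hb
    simpa [groupOp] using PolyFun.op zero_lt_one ha hb
  suffices PolyFun 1 (groupOp e) C (fun _ => e g) ∧ PolyFun 1 (groupOp e) C (fun _ => e (-g)) from
    this.1
  induction hg using AddSubgroup.closure_induction with
  | mem x hx => exact ⟨.const (hs x hx).1, .const (hs x hx).2⟩
  | zero => exact ⟨.const h0, by simpa using PolyFun.const h0⟩
  | add x y _ _ hx hy =>
    refine ⟨hadd hx.1 hy.1, ?_⟩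
    rw [neg_add]
    exact hadd hx.2 hy.2
  | neg x _ hx => exact ⟨hx.2, by rw [neg_neg]; exact hx.1⟩

/-- A group of finite rank has a finite subset such that each element has a nonzero multiple in the
subgroup generated by it. -/
theorem exists_finite_forall_zsmul_mem_closure {r : ℕ} (hr : Module.rank ℤ G = r) :
    ∃ s : Set G, s.Finite ∧ ∀ x, ∃ n : ℤ, n ≠ 0 ∧ n • x ∈ AddSubgroup.closure s := by
  obtain ⟨s, hs, hli⟩ := exists_set_linearIndependent_of_isDomain ℤ G
  have hfin : s.Finite := by
    rw [← Set.finite_coe_iff, ← Cardinal.lt_aleph0_iff_finite, hs, hr]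
    exact Cardinal.natCast_lt_aleph0
  refine ⟨s, hfin, fun x => ?_⟩
  have hq := rank_quotient_add_rank_of_isDomain (Submodule.span ℤ s)
  rw [rank_span_set hli, hs, hr] at hq
  have h0 : Module.rank ℤ (G ⧸ Submodule.span ℤ s) = 0 :=
    Cardinal.eq_of_add_eq_add_right (hq.trans (zero_add _).symm) Cardinal.natCast_lt_aleph0
  obtain ⟨n, hn, hx⟩ := rank_eq_zero_iff.1 h0 (Submodule.Quotient.mk x)
  refine ⟨n, hn, ?_⟩
  rw [← Submodule.Quotient.mk_smul, Submodule.Quotient.mk_eq_zero] at hx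
  rwa [← Submodule.mem_toAddSubgroup, Submodule.span_int_eq_addSubgroupClosure] at hx

theorem isFinitelyAlgebraic_groupOp [IsAddTorsionFree G] (e : G ≃ ℕ) {r : ℕ}
    (hr : Module.rank ℤ G = r) : IsFinitelyAlgebraic 1 (groupOp e) where
  pos := zero_lt_one
  cancel a b c h := e.symm.injective (add_right_cancel (e.injective h))
  finite _ _ hf hg hne := finite_setOf_polyFun_eq_of_group hf hg hne
  exists_gen := by
    obtain ⟨s, hfin, hs⟩ := exists_finite_forall_zsmul_mem_closure hr
    have hfin' : (insert 0 (s ∪ -s)).Finite := (hfin.union hfin.neg).insert 0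
    refine ⟨(hfin'.image e).toFinset.toList, fun x => ?_⟩
    simp only [Finset.mem_toList, Set.Finite.mem_toFinset, Set.ofPred_mem_eq]
    set C := e '' insert 0 (s ∪ -s)
    obtain ⟨n, hn, hmem⟩ := hs (e.symm x)
    obtain ⟨k, hk⟩ := Nat.exists_eq_succ_of_ne_zero (Int.natAbs_ne_zero.2 hn)
    have hmem' : (k + 1) • e.symm x ∈ AddSubgroup.closure s := by
      rw [← Nat.succ_eq_add_one, ← hk, ← natCast_zsmul]
      rcases Int.natAbs_eq n with h | h
      · rwa [← h]
      · rw [← neg_mem_iff, ← neg_smul, ← h]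
        exact hmem
    have hmul : ∀ k : ℕ, PolyFun 1 (groupOp e) C fun y => e ((k + 1) • e.symm y) := by
      intro k
      induction k with
      | zero => simpa using PolyFun.id
      | succ k ih =>
        simpa [groupOp, add_smul] using PolyFun.op zero_lt_one ih PolyFun.id
    refine ⟨_, _, hmul k, polyFun_const_of_mem_closure (s := s) ?_ ?_ hmem', rfl, fun heq => ?_⟩
    · exact Set.mem_image_of_mem e (Set.mem_insert _ _)
    · exact fun g hg => ⟨Set.mem_image_of_mem e (by simp [hg]), Set.mem_image_of_mem e (by simp [hg])⟩
    · have h := e.injective (congrFun heq (x + 1))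
      exact absurd (e.symm.injective (nsmul_right_injective k.succ_ne_zero h)) (by simp)

end Groups

/-! ### Fields of characteristic zero and finite transcendence degree -/

section Fields

variable {K : Type} [Field K]

/-- The operations of a field, transported to `ω`: addition has index `0`, and multiplication has
index `1`. -/
def fieldOp (e : K ≃ ℕ) (ρ a b : ℕ) : ℕ :=
  if ρ = 0 then e (e.symm a + e.symm b) else e (e.symm a * e.symm b)

theorem PolyFun.add {e : K ≃ ℕ} {C : Set ℕ} {f g : ℕ → K}
    (hf : PolyFun 2 (fieldOp e) C fun y => e (f y)) (hg : PolyFun 2 (fieldOp e) C fun y => e (g y)) :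
    PolyFun 2 (fieldOp e) C fun y => e (f y + g y) := by
  simpa [fieldOp] using PolyFun.op (ρ := 0) two_pos hf hg

theorem PolyFun.mul {e : K ≃ ℕ} {C : Set ℕ} {f g : ℕ → K}
    (hf : PolyFun 2 (fieldOp e) C fun y => e (f y)) (hg : PolyFun 2 (fieldOp e) C fun y => e (g y)) :
    PolyFun 2 (fieldOp e) C fun y => e (f y * g y) := by
  simpa [fieldOp] using PolyFun.op (ρ := 1) one_lt_two hf hg

open Polynomial in
theorem PolyFun.exists_polynomial {e : K ≃ ℕ} {C : Set ℕ} {f : ℕ → ℕ}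
    (hf : PolyFun 2 (fieldOp e) C f) : ∃ P : K[X], ∀ y, e.symm (f y) = P.eval (e.symm y) := by
  induction hf with
  | @const c _ => exact ⟨Polynomial.C (e.symm c), by simp⟩
  | id => exact ⟨X, by simp⟩
  | @op ρ _ f g _ _ ihf ihg =>
    obtain ⟨P, hP⟩ := ihf
    obtain ⟨Q, hQ⟩ := ihg
    by_cases hρ : ρ = 0
    · exact ⟨P + Q, fun y => by simp [fieldOp, hρ, hP, hQ]⟩
    · exact ⟨P * Q, fun y => by simp [fieldOp, hρ, hP, hQ]⟩

theorem finite_setOf_polyFun_eq_of_field {e : K ≃ ℕ} {f g : ℕ → ℕ}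
    (hf : PolyFun 2 (fieldOp e) Set.univ f) (hg : PolyFun 2 (fieldOp e) Set.univ g)
    (hne : f ≠ g) : {y | f y = g y}.Finite := by
  obtain ⟨P, hP⟩ := hf.exists_polynomial
  obtain ⟨Q, hQ⟩ := hg.exists_polynomial
  have hPQ : P - Q ≠ 0 := by
    intro h
    rw [sub_eq_zero] at h
    exact hne (funext fun y => e.symm.injective (by rw [hP, hQ, h]))
  refine ((Polynomial.finite_setOfPred_isRoot hPQ).preimage e.symm.injective.injOn).subset
    fun y hy => ?_
  have hy : f y = g y := hy
  change Polynomial.eval (e.symm y) (P - Q) = 0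
  rw [Polynomial.eval_sub, ← hP, ← hQ, hy, sub_self]

theorem polyFun_const_of_mem_adjoin {e : K ≃ ℕ} {s : Set K} {C : Set ℕ} (h1 : e 1 ∈ C)
    (hn1 : e (-1) ∈ C) (hs : ∀ a ∈ s, e a ∈ C) {a : K} (ha : a ∈ Algebra.adjoin ℤ s) :
    PolyFun 2 (fieldOp e) C fun _ => e a := by
  induction ha using Algebra.adjoin_induction with
  | mem x hx => exact .const (hs x hx)
  | algebraMap n =>
    induction n using Int.induction_on with
    | zero => simpa using (PolyFun.const h1).add (.const hn1)
    | succ n ih => simpa using ih.add (.const h1)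
    | pred n ih => simpa [sub_eq_add_neg] using ih.add (.const hn1)
  | add x y _ _ hx hy => exact hx.add hy
  | mul x y _ _ hx hy => exact hx.mul hy

open Polynomial in
theorem polyFun_aeval {e : K ≃ ℕ} {s : Set K} {C : Set ℕ} (h1 : e 1 ∈ C) (hn1 : e (-1) ∈ C)
    (hs : ∀ a ∈ s, e a ∈ C) (p : (Algebra.adjoin ℤ s)[X]) :
    PolyFun 2 (fieldOp e) C fun y => e (aeval (e.symm y) p) := by
  have hid : PolyFun 2 (fieldOp e) C fun y => e (e.symm y) := by simpa using PolyFun.id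
  induction p using Polynomial.induction_on with
  | C a => simpa using polyFun_const_of_mem_adjoin h1 hn1 hs a.2
  | add p q hp hq => simpa using hp.add hq
  | monomial n a h => simpa [pow_succ, mul_assoc] using h.mul hid

/-- A field of finite transcendence degree is algebraic over a finitely generated subring. -/
theorem exists_finite_isAlgebraic_adjoin [CharZero K] {d : ℕ} (hd : Algebra.trdeg ℚ K = d) :
    ∃ s : Set K, s.Finite ∧ Algebra.IsAlgebraic (Algebra.adjoin ℤ s) K := by
  obtain ⟨s, hs⟩ := exists_isTranscendenceBasis ℤ K
  have hQ : AlgebraicIndependent ℚ ((↑) : s → K) :=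
    have : Algebra.IsAlgebraic ℤ ℚ := IsLocalization.isAlgebraic ℚ (nonZeroDivisors ℤ)
    hs.1.extendScalars ℚ
  have hfin : s.Finite := by
    rw [← Set.finite_coe_iff, ← Cardinal.lt_aleph0_iff_finite]
    exact (hQ.cardinalMk_le_trdeg.trans_eq hd).trans_lt Cardinal.natCast_lt_aleph0
  refine ⟨s, hfin, ?_⟩
  have := hs.isAlgebraic
  rwa [Subtype.range_coe] at this

theorem isFinitelyAlgebraic_fieldOp [CharZero K] (e : K ≃ ℕ) {d : ℕ}
    (hd : Algebra.trdeg ℚ K = d) : IsFinitelyAlgebraic 2 (fieldOp e) where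
  pos := two_pos
  cancel a b c h := e.symm.injective (add_right_cancel (e.injective h))
  finite _ _ hf hg hne := finite_setOf_polyFun_eq_of_field hf hg hne
  exists_gen := by
    obtain ⟨s, hfin, hs⟩ := exists_finite_isAlgebraic_adjoin hd
    have hfin' : (insert 0 (insert 1 (insert (-1) s))).Finite := ((hfin.insert _).insert _).insert _
    refine ⟨(hfin'.image e).toFinset.toList, fun x => ?_⟩
    simp only [Finset.mem_toList, Set.Finite.mem_toFinset, Set.ofPred_mem_eq]
    have hmem : ∀ a ∈ insert 0 (insert 1 (insert (-1) s)),
        e a ∈ e '' insert 0 (insert 1 (insert (-1) s)) := fun a => Set.mem_image_of_mem e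
    obtain ⟨p, hp, hx⟩ := hs.isAlgebraic (e.symm x)
    refine ⟨_, _, polyFun_aeval (s := s) (hmem _ (by simp)) (hmem _ (by simp))
      (fun a ha => hmem _ (by simp [ha])) p, .const (hmem 0 (by simp)), congrArg e hx, fun heq => ?_⟩
    refine hp ((Polynomial.map_eq_zero_iff (FaithfulSMul.algebraMap_injective _ K)).1
      (Polynomial.eq_zero_of_infinite_isRoot _ ?_))
    refine (Set.infinite_univ (α := K)).mono fun a _ => ?_
    have := e.injective (congrFun heq (e a))
    change Polynomial.eval a _ = 0
    rw [Polynomial.eval_map_algebraMap]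
    simpa using this

end Fields

/-! ### The isomorphism relations in normal form -/

theorem tfabIso_iff_sigma03Normal {r : ℕ} (X Y : TFAbSpace r) :
    TFAbIso r X Y ↔ Sigma03Normal (isoMatrix 1) X Y := by
  have hdiag : ∀ Z : TFAbSpace r, ∃ op, IsOpDiagram 1 op Z ∧ IsFinitelyAlgebraic 1 op := by
    rintro ⟨Z, G, _, e, _, hr, he⟩
    refine ⟨groupOp e, fun ρ hρ a b c => ?_, isFinitelyAlgebraic_groupOp e hr⟩
    have h := he (e.symm a) (e.symm b) (e.symm c)
    simp only [Equiv.apply_symm_apply] at h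
    rw [Nat.lt_one_iff.1 hρ, one_mul, add_zero, h, groupOp, ← Equiv.eq_symm_apply]
  obtain ⟨op, hX, hop⟩ := hdiag X
  obtain ⟨op', hY, hop'⟩ := hdiag Y
  rw [← exists_perm_iff_sigma03Normal hX hop hY hop']
  refine exists_congr fun s => ⟨fun h t => ?_, fun h a b c => ?_⟩
  · simpa [tripleIndex, tripleLift, Nat.mod_one] using h t.unpair.1 t.unpair.2.unpair.1 t.unpair.2.unpair.2
  · simpa [tripleIndex, tripleLift, Nat.mod_one] using h (tripleIndex a b c)

theorem fdIso_iff_sigma03Normal {d : ℕ} (X Y : FDSpace d) :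
    FDIso d X Y ↔ Sigma03Normal (isoMatrix 2) X Y := by
  have hdiag : ∀ Z : FDSpace d, ∃ op, IsOpDiagram 2 op Z ∧ IsFinitelyAlgebraic 2 op := by
    rintro ⟨Z, K, _, _, e, hd, hadd, hmul⟩
    refine ⟨fieldOp e, fun ρ hρ a b c => ?_, isFinitelyAlgebraic_fieldOp e hd⟩
    have h₁ := hadd (e.symm a) (e.symm b) (e.symm c)
    have h₂ := hmul (e.symm a) (e.symm b) (e.symm c)
    simp only [Equiv.apply_symm_apply] at h₁ h₂
    obtain rfl | rfl : ρ = 0 ∨ ρ = 1 := by omega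
    · rw [add_zero, h₁, fieldOp, if_pos rfl, ← Equiv.eq_symm_apply]
    · rw [h₂, fieldOp, if_neg one_ne_zero, ← Equiv.eq_symm_apply]
  obtain ⟨op, hX, hop⟩ := hdiag X
  obtain ⟨op', hY, hop'⟩ := hdiag Y
  rw [← exists_perm_iff_sigma03Normal hX hop hY hop']
  refine exists_congr fun s => ⟨fun h t => ?_, fun h a b c => ⟨?_, ?_⟩⟩
  · obtain ⟨h₀, h₁⟩ := h (t / 2).unpair.1 (t / 2).unpair.2.unpair.1 (t / 2).unpair.2.unpair.2
    have ht : 2 * tripleIndex (t / 2).unpair.1 (t / 2).unpair.2.unpair.1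
        (t / 2).unpair.2.unpair.2 = 2 * (t / 2) := by simp [tripleIndex]
    rw [ht] at h₀ h₁
    rw [tripleLift]
    rcases Nat.mod_two_eq_zero_or_one t with hmod | hmod
    · rw [hmod, add_zero, ← h₀]
      exact congrArg _ (by omega)
    · rw [hmod, ← h₁]
      exact congrArg _ (by omega)
  · exact (h _).trans (by rw [← add_zero (2 * tripleIndex a b c), tripleLift_index two_pos]; rfl)
  · exact (h _).trans (by rw [tripleLift_index one_lt_two])

theorem mainTheorem3 :
    IsSigma03CompleteEquiv (TFAbIso 1) ∧
    UniformlyComputablyCountablyReducible {d : ℕ | 0 < d} FDIso (TFAbIso 1) ∧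
    UniformlyComputablyCountablyReducible Set.univ TFAbIso (TFAbIso 1) := by
  -- The second component of the input `⟨d, n⟩` is passed on, as one program works for all `d`.
  have huniform : ∀ {c : OracleCode} {X : CantorSeq} {d n : ℕ} {v : Part ℕ}, c.eval X n = v →
      (c.comp .right).eval X (Nat.pair d n) = v := by
    intro c X d n v h
    rw [OracleCode.eval_comp_of_eq (m := n), h]
    change Part.some (Nat.pair d n).unpair.2 = _
    rw [Nat.unpair_pair]
  refine ⟨⟨⟨_, (primrecPred_isoMatrix 1).isSigma03Set, tfabIso_iff_sigma03Normal⟩,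
    fun S E ⟨P, hP, hE⟩ => ?_⟩, ?_, ?_⟩
  · obtain ⟨V, hV, hPV⟩ := hP.exists_normal
    obtain ⟨c, hc⟩ := exists_oracleCode_reduction hV
    obtain ⟨g, hg, hred⟩ := hc S E fun A B => (hE A B).trans (hPV A B)
    exact ⟨g, ⟨c, hg⟩, hred⟩
  · obtain ⟨c, hc⟩ := exists_oracleCode_reduction (primrecPred_isoMatrix 2)
    refine ⟨c.comp .right, fun d _ => ?_⟩
    obtain ⟨g, hg, hred⟩ := hc _ (FDIso d) fdIso_iff_sigma03Normal
    exact ⟨g, fun A n => huniform (hg A n), hred⟩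
  · obtain ⟨c, hc⟩ := exists_oracleCode_reduction (primrecPred_isoMatrix 1)
    refine ⟨c.comp .right, fun r _ => ?_⟩
    obtain ⟨g, hg, hred⟩ := hc _ (TFAbIso r) tfabIso_iff_sigma03Normal
    exact ⟨g, fun A n => huniform (hg A n), hred⟩
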